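/- **Definitions.** For $m\ge 2$, $a>0$ and $x,y\in\mathbb R^m$ put $\lambda=\frac{m-2}{2}$, $z=|x||y|$ and $\xi=\langle x,y\rangle/z=\cos\theta$, with $\theta\in[0,\pi]$ the angle between $x$ and $y$ (the choice of $\theta$ is immaterial if $z=0$). The kernel of the radially deformed Fourier transform on $\mathbb R^m$ is $$K_a^m(x,y)=a^{2\lambda/a}\,\Gamma\!\left(\tfrac{2\lambda+a}{a}\right)\sum_{k=0}^\infty e^{-\frac{i\pi k}{a}}\,\frac{\lambda+k}{\lambda}\,z^{-\lambda}J_{\frac{2(k+\lambda)}{a}}\!\left(\tfrac2a z^{a/2}\right)C_k^{(\lambda)}(\xi),$$ where $J_\nu$ is the Bessel function of the first kind and $C_k^{(\lambda)}$ the Gegenbauer polynomial. For $m=2$ (that is, $\lambda=0$) the factor $\frac{\lambda+k}{\lambda}C_k^{(\lambda)}(\cos\theta)$ is read as its limit as $\lambda\to0$, which is $1$ for $k=0$ and $2\cos k\theta$ for $k\ge1$; at $z=0$ the kernel is defined by continuity, so that $K_a^m(x,y)=1$. Let $D_\nu$ be Whittaker's parabolic cylinder function, $$D_\nu(w)=2^{\nu/2}e^{-w^2/4}\left(\frac{\sqrt\pi}{\Gamma(\frac{1-\nu}{2})}\,{}_1F_1\!\left(-\tfrac\nu2;\tfrac12;\tfrac{w^2}{2}\right)-\frac{\sqrt{2\pi}\,w}{\Gamma(-\frac\nu2)}\,{}_1F_1\!\left(\tfrac{1-\nu}{2};\tfrac32;\tfrac{w^2}{2}\right)\right).$$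 **Theorem.** Let $m=2n$ with an integer $n\ge1$, and let $a=4$. Then the series above converges absolutely for all $x,y\in\mathbb R^m$ with $z\neq0$, and for all $x,y\in\mathbb R^m$ $$K_4^m(x,y)=c_n\,e^{\frac i2 z^2\sin^2\theta}\,D_{-n}\big((i-1)z\cos\theta\big),\qquad c_n=\frac{2^{n/2}\,\Gamma\!\left(\frac{n+1}{2}\right)}{\sqrt\pi}.$$ Furthermore, there is a constant $C>0$ (depending only on $m$) such that $$|K_4^m(x,y)|\le C\,(1+|x||y|)^{\frac{m-2}{2}}\qquad\text{for all }x,y\in\mathbb R^m.$$ The growth order $\frac{m-2}{2}$ is optimal: if $s\in\mathbb R$ and $C'\in\mathbb R$ are such that $|K_4^m(x,y)|\le C'(1+|x||y|)^s$ for all $x,y\in\mathbb R^m$, then $s\ge\frac{m-2}{2}$. Moreover, this growth is attained: there are $c>0$ and $R\in\mathbb R$ such that for every $r\ge R$ there are $x,y\in\mathbb R^m$ with $|x||y|=r$ and $|K_4^m(x,y)|\ge c\,(1+r)^{\frac{m-2}{2}}$. -/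

import Mathlib

noncomputable section

namespace RadialFourier

/-- The Bessel function of the first kind `J_ν(w)`, for real order `ν` and real argument `w ≥ 0`:
`J_ν(w) = ∑ⱼ (-1)ʲ / (j! Γ(j + ν + 1)) (w / 2)^(2 j + ν)`. -/
def besselJ (ν w : ℝ) : ℝ :=
  ∑' j : ℕ, (-1 : ℝ) ^ j / ((j.factorial : ℝ) * Real.Gamma ((j : ℝ) + ν + 1))
    * (w / 2) ^ (2 * (j : ℝ) + ν)

/-- The Gegenbauer polynomial `C_k^{(μ)}(ξ) =
∑_{0 ≤ j ≤ k/2} (-1)ʲ (μ)_{k-j} / (j! (k - 2 j)!) (2 ξ)^{k - 2 j}`. -/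
def gegenbauerC (μ : ℝ) (k : ℕ) (ξ : ℝ) : ℝ :=
  ∑ j ∈ Finset.range (k / 2 + 1),
    (-1 : ℝ) ^ j * (ascPochhammer ℝ (k - j)).eval μ
      / ((j.factorial : ℝ) * ((k - 2 * j).factorial : ℝ)) * (2 * ξ) ^ (k - 2 * j)

/-- The factor `((μ + k) / μ) C_k^{(μ)}(cos θ)`; for `μ = 0` its limit as `μ → 0`, which is
`1` for `k = 0` and `2 cos (k θ)` for `k ≥ 1`. -/
def zonalFactor (μ : ℝ) (k : ℕ) (θ : ℝ) : ℝ :=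
  if μ = 0 then (if k = 0 then 1 else 2 * Real.cos (k * θ))
  else (μ + k) / μ * gegenbauerC μ k (Real.cos θ)

/-- The `k`-th term `e^{-iπk/a} ((μ+k)/μ) z^{-μ} J_{2(k+μ)/a}((2/a) z^{a/2}) C_k^{(μ)}(ξ)` of the
series of the radially deformed Fourier kernel on `ℝ^m`, where `μ = (m - 2) / 2`,
`z = |x| |y| ≠ 0` and `ξ = ⟨x, y⟩ / z = cos θ`, with `θ` the angle between `x` and `y`. -/
def kernelTerm (a : ℝ) {m : ℕ} (x y : EuclideanSpace ℝ (Fin m)) (k : ℕ) : ℂ :=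
  let μ : ℝ := ((m : ℝ) - 2) / 2
  let z : ℝ := ‖x‖ * ‖y‖
  Complex.exp (-(Complex.I * (Real.pi : ℂ) * (k : ℂ) / (a : ℂ)))
    * ((zonalFactor μ k (InnerProductGeometry.angle x y)
        * z ^ (-μ) * besselJ (2 * ((k : ℝ) + μ) / a) (2 / a * z ^ (a / 2)) : ℝ) : ℂ)

/-- The kernel `K_a^m(x, y)` of the radially deformed Fourier transform on `ℝ^m`,
`a^{2μ/a} Γ((2μ + a)/a) ∑ₖ kernelTerm a x y k` with `μ = (m - 2) / 2`.
If `|x| |y| = 0` the terms of the series are read as their limits as `z = |x| |y| → 0`: the term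
`k = 0` tends to `a^{-2μ/a} / Γ((2μ + a)/a)` and the others to `0`, so the kernel is `1` there. -/
def kernel (a : ℝ) {m : ℕ} (x y : EuclideanSpace ℝ (Fin m)) : ℂ :=
  let μ : ℝ := ((m : ℝ) - 2) / 2
  if ‖x‖ * ‖y‖ = 0 then 1
  else ((a ^ (2 * μ / a) * Real.Gamma ((2 * μ + a) / a) : ℝ) : ℂ) * ∑' k : ℕ, kernelTerm a x y k

/-- Kummer's confluent hypergeometric function `M(α, β, w) = ₁F₁(α; β; w) =
∑ₖ (α)ₖ / ((β)ₖ k!) wᵏ`, for `β ≠ 0, -1, -2, …`. -/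
def kummerM (α β w : ℂ) : ℂ :=
  Complex.Gamma β * Complex.regularizedHGFun {α} {β} w

/-- Whittaker's parabolic cylinder function `D_ν(w) = U(-ν - 1/2, w)`:
`2^{ν/2} e^{-w²/4} (√π / Γ((1-ν)/2) M(-ν/2, 1/2, w²/2) - √(2π) w / Γ(-ν/2) M((1-ν)/2, 3/2, w²/2))`,
where `1 / Γ` is the entire reciprocal Gamma function (zero at the poles of `Γ`, as here). -/
def parabolicCylinderD (ν w : ℂ) : ℂ :=
  (2 : ℂ) ^ (ν / 2) * Complex.exp (-(w ^ 2 / 4)) *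
    ((Real.sqrt Real.pi : ℂ) / Complex.Gamma ((1 - ν) / 2)
        * kummerM (-(ν / 2)) (1 / 2) (w ^ 2 / 2)
      - (Real.sqrt (2 * Real.pi) : ℂ) * w / Complex.Gamma (-(ν / 2))
        * kummerM ((1 - ν) / 2) (3 / 2) (w ^ 2 / 2))

end RadialFourier

end

namespace RadialFourier

open Finset
open scoped Nat

/-! Put l = n - 1, z = |x||y|, ω = e^{-iπ/4}, w = ωz/2. For a = 4 the Bessel functions have order (k
+ l)/2 and argument z²/2, so expanding them together with the zonal polynomials turns the kernel
into a triple series in X = 2w cos θ and Y = w². The identity ω⁴ = -1 absorbs both the phase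
e^{-iπk/4} and the Bessel signs into powers of w. The triple series converges absolutely, hence may
be regrouped.

For a fixed power X^p and total degree q in Y the coefficients form a finite sum with a closed form
(`sum_zonalCoeff_div_Gamma`), because that sum satisfies (q + 1) S_{q+1} = 2 S_q. The q-sum is then
an exponential and, with F_n(T) = ∑ Γ((n + p)/2) T^p / p!, K = e^{iz²/2} F_n(2ω z cos θ) / Γ(n/2).
The even and odd parts of F_n are the two Kummer functions in D_{-n}, which gives the closed form.

Since the exponential is unimodular, growth is a question about F_n on the line ωℝ. There e^{it²}
F_1(2ωt) = √π + 2ω ∫₀ᵗ e^{is²} ds is a bounded Fresnel integral, and its values at t and -t add up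
to 2√π, so one of them has modulus at least √π. The recurrence F_{n+2} = (n/2) F_n + (T/2) F_{n+1}
gives F_n(2ωt) = (ωt)^{n-1} F_1(2ωt) plus terms of lower order. Both the upper bound and its
sharpness follow, the latter on collinear x, y. -/

/-! ### Zonal factors as polynomials in 2 cos θ -/

theorem chebyshevU_eval_eq_sum_antidiagonal (x : ℝ) (k : ℕ) :
    (Polynomial.Chebyshev.U ℝ k).eval x =
      ∑ a ∈ antidiagonal k, (-1) ^ a.2 * (a.1.choose a.2 : ℝ) * (2 * x) ^ (a.1 - a.2) := by
  induction k using Nat.twoStepInduction with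
  | zero => simp
  | one => simp [Finset.Nat.antidiagonal_succ]
  | more k ih₁ ih₂ =>
    have h := Polynomial.Chebyshev.U_add_two ℝ (k : ℤ)
    -- Pascal's rule in the shape of U_{k+2} = 2x U_{k+1} - U_k. For a ≤ b the truncated exponent a
    -- - (b + 1) is harmless, as its binomial coefficient vanishes.
    have hstep : ∀ a b : ℕ,
        (-1 : ℝ) ^ (b + 1) * ((a + 1).choose (b + 1) : ℝ) * (2 * x) ^ (a + 1 - (b + 1)) =
          2 * x * ((-1) ^ (b + 1) * (a.choose (b + 1) : ℝ) * (2 * x) ^ (a - (b + 1)))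
            - (-1) ^ b * (a.choose b : ℝ) * (2 * x) ^ (a - b) := by
      intro a b
      rw [Nat.choose_succ_succ]
      rcases le_or_gt a b with hab | hab
      · rw [Nat.choose_eq_zero_of_lt (by omega : a < b + 1)]
        rw [Nat.add_sub_add_right]
        push_cast
        ring
      · obtain ⟨c, rfl⟩ := Nat.exists_eq_add_of_lt hab
        rw [show b + c + 1 + 1 - (b + 1) = c + 1 by omega,
          show b + c + 1 - (b + 1) = c by omega, show b + c + 1 - b = c + 1 by omega]
        push_cast
        ring
    push_cast at ih₁ ih₂ ⊢
    rw [h]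
    simp only [Polynomial.eval_sub, Polynomial.eval_mul, Polynomial.eval_X,
      Polynomial.eval_ofNat, ih₁, ih₂]
    rw [Finset.Nat.antidiagonal_succ_succ', Finset.Nat.antidiagonal_succ']
    simp only [sum_cons, sum_map, Function.Embedding.prodMap, Function.Embedding.coeFn_mk,
      Prod.map, Function.Embedding.refl_apply, mul_add, mul_sum, Nat.succ_eq_add_one, hstep,
      sum_sub_distrib]
    simp
    ring

theorem chebyshevU_eval_eq_sum_range (x : ℝ) (k : ℕ) :
    (Polynomial.Chebyshev.U ℝ k).eval x =
      ∑ i ∈ range (k / 2 + 1),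
        (-1) ^ i * ((k - i).choose i : ℝ) * (2 * x) ^ (k - 2 * i) := by
  rw [chebyshevU_eval_eq_sum_antidiagonal, ← Finset.Nat.sum_antidiagonal_swap]
  simp only [Prod.fst_swap, Prod.snd_swap]
  rw [Finset.Nat.sum_antidiagonal_eq_sum_range_succ_mk]
  symm
  have hsub : range (k / 2 + 1) ⊆ range (k + 1) := by
    intro i; simp only [mem_range]; omega
  rw [Finset.sum_congr rfl (g := fun i => (-1 : ℝ) ^ i * ((k - i).choose i : ℝ) *
    (2 * x) ^ (k - i - i)) (fun i _ => by rw [Nat.sub_sub, ← two_mul])]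
  refine Finset.sum_subset hsub fun i _ hi => ?_
  rw [Nat.choose_eq_zero_of_lt (by simp only [mem_range] at hi; omega)]
  simp

/-- The absolute value of the coefficient of `(2 ξ)^p` in `((l + k) / l) C_k^{(l)}(ξ)`,
where `k = p + 2 i`. -/
noncomputable def zonalCoeff (l i p : ℕ) : ℝ :=
  (((l + p + i)! : ℝ) + i * ((l + p + i - 1)! : ℝ)) / ((l ! : ℝ) * (i ! : ℝ) * (p ! : ℝ))

theorem zonalCoeff_zero_left_succ (i p : ℕ) :
    zonalCoeff 0 (i + 1) p = ((p + (i + 1)).choose (i + 1) : ℝ) + ((p + i).choose i : ℝ) := by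
  rw [add_comm p (i + 1), add_comm p i, Nat.cast_add_choose, Nat.cast_add_choose, zonalCoeff,
    show 0 + p + (i + 1) - 1 = i + p by omega, show 0 + p + (i + 1) = i + 1 + p by omega, Nat.factorial_succ i]
  push_cast
  have h1 : (i ! : ℝ) ≠ 0 := by positivity
  have h2 : (p ! : ℝ) ≠ 0 := by positivity
  have h3 : (i : ℝ) + 1 ≠ 0 := by positivity
  field_simp
  simp

theorem zonalCoeff_zero_left_zero (p : ℕ) : zonalCoeff 0 0 p = 1 := by
  have h2 : (p ! : ℝ) ≠ 0 := by positivity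
  simp [zonalCoeff, h2]

/-- Comes from 2 T_k = U_k - U_{k-2}: the two Chebyshev sums supply the two binomial coefficients
that make up `zonalCoeff 0`. -/
theorem two_mul_cos_nat_mul_eq_sum (k : ℕ) (hk : k ≠ 0) (θ : ℝ) :
    2 * Real.cos (k * θ) = ∑ i ∈ range (k / 2 + 1),
      (-1) ^ i * zonalCoeff 0 i (k - 2 * i) * (2 * Real.cos θ) ^ (k - 2 * i) := by
  have hT := Polynomial.Chebyshev.T_real_cos θ k
  push_cast at hT
  rw [← hT]
  rcases k with _ | _ | k
  · exact absurd rfl hk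
  · simp [zonalCoeff_zero_left_zero]
  · have h := congrArg (Polynomial.eval (Real.cos θ))
      (Polynomial.Chebyshev.two_mul_T_eq_U_sub_U ℝ (k : ℤ))
    simp only [Polynomial.eval_mul, Polynomial.eval_ofNat, Polynomial.eval_sub] at h
    push_cast
    rw [show ((k : ℤ) + 1 + 1) = (k : ℤ) + 2 by ring, h]
    rw [show ((k : ℤ) + 2) = ((k + 2 : ℕ) : ℤ) by push_cast; ring, chebyshevU_eval_eq_sum_range,
      chebyshevU_eval_eq_sum_range, show (k + 2) / 2 + 1 = k / 2 + 1 + 1 by omega,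
      sum_range_succ' _ (k / 2 + 1),
      sum_range_succ' _ (k / 2 + 1), add_sub_right_comm, ← sum_sub_distrib]
    congr 1
    · refine sum_congr rfl fun i hi => ?_
      have hi' : 2 * i ≤ k := by simp only [mem_range] at hi; omega
      obtain ⟨p, rfl⟩ := Nat.exists_eq_add_of_le hi'
      rw [show 2 * i + p + 1 + 1 - 2 * (i + 1) = p by omega,
        show 2 * i + p + 2 - (i + 1) = p + (i + 1) by omega,
        show 2 * i + p - i = p + i by omega, show 2 * i + p - 2 * i = p by omega,
        zonalCoeff_zero_left_succ]
      ring
    · simp [zonalCoeff_zero_left_zero]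

theorem ascPochhammer_eval_natCast_succ (l r : ℕ) :
    (ascPochhammer ℝ r).eval ((l + 1 : ℕ) : ℝ) * (l ! : ℝ) = ((l + r)! : ℝ) := by
  rw [← ascPochhammer_eval_cast, ascPochhammer_nat_eq_ascFactorial, ← Nat.factorial_mul_ascFactorial]
  push_cast
  ring

/-- The explicit expansion of the zonal factor in powers of `2 cos θ`, for integer parameter. -/
theorem zonalFactor_natCast_eq_sum (l k : ℕ) (θ : ℝ) :
    zonalFactor l k θ = ∑ i ∈ range (k / 2 + 1),
      (-1) ^ i * zonalCoeff l i (k - 2 * i) * (2 * Real.cos θ) ^ (k - 2 * i) := by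
  rcases l with _ | l
  · rcases eq_or_ne k 0 with rfl | hk
    · simp [zonalFactor, zonalCoeff_zero_left_zero]
    · rw [← two_mul_cos_nat_mul_eq_sum k hk]
      simp [zonalFactor, hk]
  -- With k = p + 2i, splitting (l + 1) + k as ((l + 1) + p + i) + i produces the two factorials in
  -- `zonalCoeff`.
  · rw [zonalFactor, if_neg (by positivity), gegenbauerC, mul_sum]
    refine sum_congr rfl fun i hi => ?_
    have hi' : 2 * i ≤ k := by simp only [mem_range] at hi; omega
    obtain ⟨p, rfl⟩ := Nat.exists_eq_add_of_le hi'
    have h := ascPochhammer_eval_natCast_succ l (p + i)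
    rw [show 2 * i + p - 2 * i = p by omega, show 2 * i + p - i = p + i by omega, zonalCoeff,
      show l + 1 + p + i - 1 = l + (p + i) by omega,
      show l + 1 + p + i = l + (p + i) + 1 by omega, Nat.factorial_succ (l + (p + i)),
      Nat.factorial_succ l]
    push_cast at h ⊢
    rw [← h]
    have h1 : (i ! : ℝ) ≠ 0 := by positivity
    have h2 : (p ! : ℝ) ≠ 0 := by positivity
    have h3 : (l ! : ℝ) ≠ 0 := by positivity
    have h4 : (l : ℝ) + 1 ≠ 0 := by positivity
    field_simp
    ring

theorem zonalCoeff_nonneg (l i p : ℕ) : 0 ≤ zonalCoeff l i p := by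
  unfold zonalCoeff; positivity

/-- Up to the factor 2 this is a trinomial coefficient, a product of two binomials each at most
2^(l+p+i). -/
theorem zonalCoeff_le (l i p : ℕ) : zonalCoeff l i p ≤ 2 * 4 ^ (l + p + i) := by
  have h1 : (i : ℝ) * ((l + p + i - 1)! : ℝ) ≤ ((l + p + i)! : ℝ) := by
    rcases i with _ | i
    · simp
    · rw [show l + p + (i + 1) - 1 = l + p + i by omega, show l + p + (i + 1) = l + p + i + 1 by rfl,
        Nat.factorial_succ]
      push_cast
      gcongr
      linarith [(l.cast_nonneg : (0 : ℝ) ≤ l), (p.cast_nonneg : (0 : ℝ) ≤ p)]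
  have h2 : ((l + p + i)! : ℝ) = ((l + (p + i)).choose l : ℝ) * ((p + i).choose p : ℝ)
      * ((l ! : ℝ) * (i ! : ℝ) * (p ! : ℝ)) := by
    rw [Nat.cast_add_choose, Nat.cast_add_choose, add_assoc]
    field_simp
  have h3 : ((l + (p + i)).choose l : ℝ) ≤ 2 ^ (l + p + i) := by
    rw [add_assoc]; exact_mod_cast Nat.choose_le_two_pow _ _
  have h4 : ((p + i).choose p : ℝ) ≤ 2 ^ (l + p + i) :=
    (show ((p + i).choose p : ℝ) ≤ 2 ^ (p + i) by exact_mod_cast Nat.choose_le_two_pow _ _).trans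
      (pow_le_pow_right₀ (by norm_num) (by omega))
  rw [zonalCoeff, div_le_iff₀ (by positivity)]
  calc _ ≤ 2 * ((l + p + i)! : ℝ) := by linarith
    _ = 2 * (((l + (p + i)).choose l : ℝ) * ((p + i).choose p : ℝ))
      * ((l ! : ℝ) * (i ! : ℝ) * (p ! : ℝ)) := by rw [h2]; ring
    _ ≤ 2 * (2 ^ (l + p + i) * 2 ^ (l + p + i)) * ((l ! : ℝ) * (i ! : ℝ) * (p ! : ℝ)) := by gcongr
    _ = _ := by rw [← mul_pow]; norm_num

/-! ### Closed form of the coefficients of equal degree -/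

/-- The summand of the finite sum that collects the terms of equal degree. -/
noncomputable def degreeTerm (A q j : ℕ) : ℝ :=
  (((A + (q - 2 * j))! : ℝ) + ((q - 2 * j : ℕ) : ℝ) * ((A + (q - 2 * j) - 1)! : ℝ)) / ((q - 2 * j)! : ℝ)
    / ((j ! : ℝ) * Real.Gamma (((q - j : ℕ) : ℝ) + (A : ℝ) / 2 + 1))

/-- Each summand at level q splits as g j + f j, one part per factorial in its numerator. At level q
+ 1 the summand with index j + 1 recombines g (j + 1) with f j, so the sums agree after a shift. The
parity of q decides the last index: f vanishes there for even q, and one extra summand absorbs it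
for odd q. -/
theorem succ_mul_sum_degreeTerm_succ (A q : ℕ) :
    ((q : ℝ) + 1) * ∑ j ∈ range ((q + 1) / 2 + 1), degreeTerm A (q + 1) j =
      2 * ∑ j ∈ range (q / 2 + 1), degreeTerm A q j := by
  set f : ℕ → ℝ := fun j => ((q - 2 * j : ℕ) : ℝ) * ((A + (q - 2 * j) - 1)! : ℝ) / ((q - 2 * j)! : ℝ)
    / ((j ! : ℝ) * Real.Gamma (((q - j : ℕ) : ℝ) + (A : ℝ) / 2 + 1)) with hf
  set g : ℕ → ℝ := fun j => ((A + (q - 2 * j))! : ℝ) / ((q - 2 * j)! : ℝ)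
    / ((j ! : ℝ) * Real.Gamma (((q - j : ℕ) : ℝ) + (A : ℝ) / 2 + 1)) with hg
  have hfg : ∀ j, degreeTerm A q j = g j + f j := by
    intro j; simp only [degreeTerm, hf, hg]; ring
  have hG : ∀ s : ℕ, Real.Gamma (((s + 1 : ℕ) : ℝ) + (A : ℝ) / 2 + 1) =
      ((s : ℝ) + 1 + (A : ℝ) / 2) * Real.Gamma ((s : ℝ) + (A : ℝ) / 2 + 1) := by
    intro s
    rw [show ((s + 1 : ℕ) : ℝ) + (A : ℝ) / 2 + 1 = ((s : ℝ) + (A : ℝ) / 2 + 1) + 1 by push_cast; ring,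
      Real.Gamma_add_one (by positivity)]
    ring
  have hGp : ∀ s : ℕ, Real.Gamma ((s : ℝ) + (A : ℝ) / 2 + 1) ≠ 0 := fun s =>
    (Real.Gamma_pos_of_pos (by positivity)).ne'
  have key0 : ((q : ℝ) + 1) * degreeTerm A (q + 1) 0 = 2 * g 0 := by
    simp only [degreeTerm, hg, mul_zero, Nat.sub_zero, hG, ← Nat.add_assoc, Nat.add_sub_cancel,
      Nat.factorial_succ]
    have h1 := hGp q
    have h2 : (q : ℝ) + 1 + (A : ℝ) / 2 ≠ 0 := by positivity
    have h3 : 2 * ((q : ℝ) + 1) + A ≠ 0 := by positivity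
    push_cast
    field_simp
    ring
  have key : ∀ j, 2 * (j + 1) ≤ q →
      ((q : ℝ) + 1) * degreeTerm A (q + 1) (j + 1) = 2 * (g (j + 1) + f j) := by
    intro j hj
    obtain ⟨k, rfl⟩ := Nat.exists_eq_add_of_le hj
    simp only [degreeTerm, hf, hg]
    rw [show 2 * (j + 1) + k + 1 - 2 * (j + 1) = k + 1 by omega,
      show 2 * (j + 1) + k + 1 - (j + 1) = j + k + 1 + 1 by omega,
      show 2 * (j + 1) + k - 2 * (j + 1) = k by omega,
      show 2 * (j + 1) + k - (j + 1) = j + k + 1 by omega,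
      show 2 * (j + 1) + k - 2 * j = k + 2 by omega,
      show 2 * (j + 1) + k - j = j + k + 1 + 1 by omega, hG]
    rw [show A + (k + 1) - 1 = A + k by omega, show A + (k + 2) - 1 = A + k + 1 by omega,
      show A + (k + 1) = A + k + 1 by rfl]
    simp only [Nat.factorial_succ]
    have h1 := hGp (j + k + 1)
    have h2 : ((j + k + 1 : ℕ) : ℝ) + 1 + (A : ℝ) / 2 ≠ 0 := by positivity
    have h3 : 2 * ((j : ℝ) + k + 1 + 1) + A ≠ 0 := by positivity
    push_cast at h1 h2 ⊢
    field_simp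
    ring
  have flast : ∀ M, q = 2 * M → f M = 0 := by
    intro M hM; simp [hf, hM]
  rw [mul_sum, mul_sum, sum_range_succ', key0]
  simp only [hfg, mul_add, sum_add_distrib]
  rcases Nat.even_or_odd' q with ⟨M, hM | hM⟩
  · rw [show (q + 1) / 2 = M by omega, show q / 2 = M by omega,
      sum_range_succ' (fun j => 2 * g j), sum_range_succ (fun j => 2 * f j), flast M hM,
      sum_congr rfl (g := fun j => 2 * g (j + 1) + 2 * f j)
        (fun j hj => by rw [key j (by simp only [mem_range] at hj; omega)]; ring),
      sum_add_distrib]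
    ring
  · have hlast : ((q : ℝ) + 1) * degreeTerm A (q + 1) (M + 1) = 2 * f M := by
      simp only [degreeTerm, hf, hM]
      rw [show 2 * M + 1 + 1 - 2 * (M + 1) = 0 by omega,
        show 2 * M + 1 + 1 - (M + 1) = M + 1 by omega, show 2 * M + 1 - 2 * M = 1 by omega,
        show 2 * M + 1 - M = M + 1 by omega]
      have h1 := hGp (M + 1)
      simp only [Nat.factorial_succ]
      push_cast at h1 ⊢
      field_simp
      simp
      left
      ring
    rw [show (q + 1) / 2 = M + 1 by omega, show q / 2 = M by omega,
      sum_range_succ (fun j => ((q : ℝ) + 1) * degreeTerm A (q + 1) (j + 1)), hlast,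
      sum_range_succ' (fun j => 2 * g j), sum_range_succ (fun j => 2 * f j),
      sum_congr rfl (g := fun j => 2 * g (j + 1) + 2 * f j)
        (fun j hj => by rw [key j (by simp only [mem_range] at hj; omega)]; ring),
      sum_add_distrib]
    ring

theorem sum_degreeTerm (A q : ℕ) :
    ∑ j ∈ range (q / 2 + 1), degreeTerm A q j =
      (A ! : ℝ) / Real.Gamma ((A : ℝ) / 2 + 1) * (2 ^ q / (q ! : ℝ)) := by
  induction q with
  | zero => simp [degreeTerm]
  | succ q ih =>
    have h := succ_mul_sum_degreeTerm_succ A q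
    rw [ih] at h
    have hq : (q : ℝ) + 1 ≠ 0 := by positivity
    rw [← mul_left_cancel_iff_of_pos (show (0 : ℝ) < (q : ℝ) + 1 by positivity), h,
      Nat.factorial_succ]
    push_cast
    field_simp
    ring

/-- A form of the duplication formula for the Gamma function at half-integers. -/
theorem factorial_div_Gamma_half_add_one (A : ℕ) :
    (A ! : ℝ) / Real.Gamma ((A : ℝ) / 2 + 1) =
      2 ^ A / √Real.pi * Real.Gamma (((A : ℝ) + 1) / 2) := by
  have h := Real.Gamma_mul_Gamma_add_half (((A : ℝ) + 1) / 2)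
  rw [show ((A : ℝ) + 1) / 2 + 1 / 2 = (A : ℝ) / 2 + 1 by ring,
    show 2 * (((A : ℝ) + 1) / 2) = (A : ℝ) + 1 by ring, Real.Gamma_nat_eq_factorial,
    show 1 - ((A : ℝ) + 1) = -(A : ℝ) by ring, Real.rpow_neg (by norm_num), Real.rpow_natCast] at h
  have h1 : Real.Gamma ((A : ℝ) / 2 + 1) ≠ 0 := (Real.Gamma_pos_of_pos (by positivity)).ne'
  have h2 : √Real.pi ≠ 0 := (Real.sqrt_pos.2 Real.pi_pos).ne'
  rw [div_eq_iff h1, div_mul_eq_mul_div, div_mul_eq_mul_div, mul_assoc, h]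
  field_simp

/-- The terms of degree `p` in `ξ` and `p + 2 q` in `z` of the kernel add up to a product. -/
theorem sum_zonalCoeff_div_Gamma (l p q : ℕ) :
    Real.Gamma (((l : ℝ) + 2) / 2) * ∑ j ∈ range (q / 2 + 1), zonalCoeff l (q - 2 * j) p /
        ((j ! : ℝ) * Real.Gamma (((q - j : ℕ) : ℝ) + ((l + p : ℕ) : ℝ) / 2 + 1)) =
      2 ^ q / (q ! : ℝ) * (2 ^ p / (p ! : ℝ)) *
        (Real.Gamma (((l : ℝ) + 1 + p) / 2) / Real.Gamma (((l : ℝ) + 1) / 2)) := by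
  have h1 : ∀ j, zonalCoeff l (q - 2 * j) p /
        ((j ! : ℝ) * Real.Gamma (((q - j : ℕ) : ℝ) + ((l + p : ℕ) : ℝ) / 2 + 1)) =
      1 / ((l ! : ℝ) * (p ! : ℝ)) * degreeTerm (l + p) q j := by
    intro j
    rw [zonalCoeff, degreeTerm]
    simp only [div_eq_mul_inv, mul_inv]
    ring
  have h2 := factorial_div_Gamma_half_add_one l
  have h3 : Real.Gamma ((l : ℝ) / 2 + 1) ≠ 0 := (Real.Gamma_pos_of_pos (by positivity)).ne'
  have h4 : Real.Gamma (((l : ℝ) + 1) / 2) ≠ 0 := (Real.Gamma_pos_of_pos (by positivity)).ne'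
  have h5 : √Real.pi ≠ 0 := (Real.sqrt_pos.2 Real.pi_pos).ne'
  have h6 : (l ! : ℝ) ≠ 0 := by positivity
  rw [div_eq_iff h3] at h2
  rw [sum_congr rfl (fun j _ => h1 j), ← mul_sum, sum_degreeTerm, factorial_div_Gamma_half_add_one,
    show ((l : ℝ) + 2) / 2 = (l : ℝ) / 2 + 1 by ring]
  push_cast
  rw [show ((l : ℝ) + p + 1) / 2 = ((l : ℝ) + 1 + p) / 2 by ring, pow_add]
  generalize Real.Gamma (((l : ℝ) + 1 + p) / 2) = X
  rw [h2]
  field_simp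

/-! ### The kernel as an absolutely convergent triple series -/

/-- Rearrangement of a double series along the lines `p + 2 i = k`. -/
theorem hasSum_sum_range_half {f : ℕ × ℕ → ℂ} (hf : Summable f) :
    HasSum (fun k => ∑ i ∈ range (k / 2 + 1), f (k - 2 * i, i)) (∑' x, f x) := by
  let e₀ : (Σ k : ℕ, (range (k / 2 + 1) : Finset ℕ)) → ℕ × ℕ := fun a => (a.1 - 2 * a.2.1, a.2.1)
  have he : Function.Bijective e₀ := by
    constructor
    · rintro ⟨k, i, hi⟩ ⟨k', i', hi'⟩ h
      simp only [e₀, Prod.mk.injEq] at h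
      simp only [mem_range] at hi hi'
      obtain ⟨h1, rfl⟩ := h
      obtain rfl : k = k' := by omega
      rfl
    · rintro ⟨p, i⟩
      exact ⟨⟨p + 2 * i, i, by simp only [mem_range]; omega⟩, by simp [e₀]⟩
  let e := Equiv.ofBijective e₀ he
  have h1 : HasSum (f ∘ e) (∑' x, f x) := (Equiv.hasSum_iff e).2 hf.hasSum
  have h2 := h1.sigma (g := fun k => ∑ i ∈ range (k / 2 + 1), f (k - 2 * i, i)) (fun k => by
    rw [← Finset.sum_coe_sort]
    exact hasSum_fintype _)
  exact h2

/-- Keep only x > R in Euler's integral and use x^s ≥ R^s there. As R is free, 1/Γ decays faster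
than any prescribed geometric rate. -/
theorem exp_neg_mul_rpow_le_Gamma_add_one {R s : ℝ} (hR : 0 < R) (hs : 0 ≤ s) :
    Real.exp (-R) * R ^ s ≤ Real.Gamma (s + 1) := by
  have hint := Real.GammaIntegral_convergent (show 0 < s + 1 by positivity)
  rw [add_sub_cancel_right] at hint
  rw [Real.Gamma_eq_integral (by positivity), add_sub_cancel_right, ← integral_exp_neg_Ioi,
    ← MeasureTheory.integral_mul_const]
  refine (MeasureTheory.setIntegral_mono_on ((integrableOn_exp_neg_Ioi R).mul_const _)
    (hint.mono_set (Set.Ioi_subset_Ioi hR.le)) measurableSet_Ioi fun x hx => ?_).trans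
    (MeasureTheory.setIntegral_mono_set hint ?_ (Set.Ioi_subset_Ioi hR.le).eventuallyLE)
  · have : R ≤ x := (Set.mem_Ioi.1 hx).le
    gcongr
  · refine (MeasureTheory.ae_restrict_iff' measurableSet_Ioi).2 (.of_forall fun x hx => ?_)
    have : (0 : ℝ) < x := hx
    simp only [Pi.zero_apply]
    positivity

/-- The kernel as a triple series: `x` stands for `2 w cos θ` and `y` for `w ^ 2`, where
`w = e^{-iπ/4} z / 2`. -/
noncomputable def tripleTerm (l : ℕ) (x y : ℂ) (p i j : ℕ) : ℂ :=
  (((-1) ^ i * zonalCoeff l i p /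
    ((j ! : ℝ) * Real.Gamma (((i + j : ℕ) : ℝ) + ((l + p : ℕ) : ℝ) / 2 + 1)) : ℝ) : ℂ)
    * (x ^ p * y ^ (i + 2 * j))

theorem norm_tripleTerm_le (l : ℕ) (x y : ℂ) (p i j : ℕ) {T : ℝ} (hT : 1 ≤ T) :
    ‖tripleTerm l x y p i j‖ ≤ 2 * 4 ^ l * Real.exp (T ^ 2) *
      ((4 * ‖x‖ / T) ^ p * (4 * ‖y‖ / T ^ 2) ^ i * (‖y‖ ^ 2 / T ^ 2) ^ j) := by
  have hT0 : 0 < T := by linarith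
  -- R = T² turns the half-integer exponent into a natural power of T.
  have hG := exp_neg_mul_rpow_le_Gamma_add_one (R := T ^ 2)
    (s := ((i + j : ℕ) : ℝ) + ((l + p : ℕ) : ℝ) / 2) (by positivity) (by positivity)
  have hpow : (T ^ 2) ^ (((i + j : ℕ) : ℝ) + ((l + p : ℕ) : ℝ) / 2) = T ^ (2 * (i + j) + (l + p)) := by
    rw [← Real.rpow_natCast T 2, ← Real.rpow_mul hT0.le, ← Real.rpow_natCast T]
    congr 1; push_cast; ring
  have hle : T ^ (2 * (i + j) + p) ≤ T ^ (2 * (i + j) + (l + p)) :=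
    pow_le_pow_right₀ hT (by omega)
  have hden : Real.exp (-T ^ 2) * T ^ (2 * (i + j) + p) ≤
      (j ! : ℝ) * Real.Gamma (((i + j : ℕ) : ℝ) + ((l + p : ℕ) : ℝ) / 2 + 1) := by
    rw [hpow] at hG
    have h1 : (1 : ℝ) ≤ j ! := by exact_mod_cast Nat.succ_le_of_lt j.factorial_pos
    calc _ ≤ Real.exp (-T ^ 2) * T ^ (2 * (i + j) + (l + p)) := by gcongr
      _ ≤ 1 * Real.Gamma (((i + j : ℕ) : ℝ) + ((l + p : ℕ) : ℝ) / 2 + 1) := by rw [one_mul]; exact hG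
      _ ≤ _ := by
        gcongr
  have hden0 : 0 < Real.exp (-T ^ 2) * T ^ (2 * (i + j) + p) := by positivity
  rw [tripleTerm, norm_mul, Complex.norm_real, norm_mul, norm_pow, norm_pow, Real.norm_eq_abs,
    abs_div, abs_mul, abs_pow, abs_neg, abs_one, one_pow, one_mul,
    abs_of_nonneg (zonalCoeff_nonneg _ _ _), abs_of_pos (hden0.trans_le hden)]
  calc _ ≤ 2 * 4 ^ (l + p + i) / (Real.exp (-T ^ 2) * T ^ (2 * (i + j) + p))
        * (‖x‖ ^ p * ‖y‖ ^ (i + 2 * j)) := by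
        gcongr
        exact zonalCoeff_le l i p
    _ = _ := by
      rw [Real.exp_neg]
      simp only [div_pow, mul_pow, pow_add, pow_mul]
      field_simp

theorem summable_tripleTerm (l : ℕ) (x y : ℂ) :
    Summable fun a : (ℕ × ℕ) × ℕ => tripleTerm l x y a.1.1 a.1.2 a.2 := by
  have hx := norm_nonneg x
  have hy := norm_nonneg y
  -- Large enough that all three geometric ratios are below 1.
  set T : ℝ := 1 + 4 * ‖x‖ + 4 * ‖y‖ with hTdef
  have hT : 1 ≤ T := by linarith
  have hT2 : T ≤ T ^ 2 := by nlinarith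
  have h1 : 4 * ‖x‖ / T < 1 := by rw [div_lt_one (by linarith)]; linarith
  have h2 : 4 * ‖y‖ / T ^ 2 < 1 := by rw [div_lt_one (by positivity)]; linarith
  have h3 : ‖y‖ ^ 2 / T ^ 2 < 1 := by
    rw [div_lt_one (by positivity)]
    exact pow_lt_pow_left₀ (by linarith) hy (by norm_num)
  refine Summable.of_norm_bounded ?_ (fun a => norm_tripleTerm_le l x y a.1.1 a.1.2 a.2 hT)
  refine Summable.mul_left _ ?_
  have hg1 := summable_geometric_of_lt_one (by positivity) h1
  have hg2 := summable_geometric_of_lt_one (by positivity) h2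
  have hg3 := summable_geometric_of_lt_one (by positivity) h3
  exact (hg1.mul_of_nonneg hg2 (fun _ => by positivity) (fun _ => by positivity)).mul_of_nonneg hg3
    (fun _ => by positivity) (fun _ => by positivity)

theorem hasSum_sum_tsum_tripleTerm (l : ℕ) (x y : ℂ) :
    HasSum (fun k => ∑ i ∈ range (k / 2 + 1), ∑' j, tripleTerm l x y (k - 2 * i) i j)
      (∑' a : (ℕ × ℕ) × ℕ, tripleTerm l x y a.1.1 a.1.2 a.2) := by
  have hs := summable_tripleTerm l x y
  have h1 := hasSum_sum_range_half hs.prod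
  rwa [← hs.tsum_prod] at h1

/-- Summation of the triple series along lines of equal degree. -/
theorem Gamma_mul_tsum_tripleTerm (l : ℕ) (x y : ℂ) :
    (Real.Gamma (((l : ℝ) + 2) / 2) : ℂ) *
        ∑' a : (ℕ × ℕ) × ℕ, tripleTerm l x y a.1.1 a.1.2 a.2 =
      Complex.exp (-(2 * y)) / (Real.Gamma (((l : ℝ) + 1) / 2) : ℂ) *
        ∑' p : ℕ, (Real.Gamma (((l : ℝ) + 1 + p) / 2) : ℂ) * (2 * x) ^ p / (p ! : ℂ) := by
  have hs : Summable fun b : ℕ × ℕ × ℕ => tripleTerm l x y b.1 b.2.1 b.2.2 :=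
    (Equiv.prodAssoc ℕ ℕ ℕ).symm.summable_iff.2 (summable_tripleTerm l x y)
  rw [← (Equiv.prodAssoc ℕ ℕ ℕ).symm.tsum_eq]
  simp only [Equiv.prodAssoc_symm_apply]
  rw [hs.tsum_prod, ← tsum_mul_left, ← tsum_mul_left]
  refine tsum_congr fun p => ?_
  have h1 := hasSum_sum_range_half (hs.prod_factor p)
  rw [← h1.tsum_eq, ← tsum_mul_left]
  -- On the line i + 2j = q the sign (-1)^i equals (-1)^q, so it leaves the finite sum and ends up
  -- in the exponential series of -2y.
  have h2 : ∀ q : ℕ, (Real.Gamma (((l : ℝ) + 2) / 2) : ℂ) * ∑ j ∈ range (q / 2 + 1),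
      tripleTerm l x y p (q - 2 * j) j =
      (Real.Gamma (((l : ℝ) + 1 + p) / 2) : ℂ) / (Real.Gamma (((l : ℝ) + 1) / 2) : ℂ)
        * ((2 * x) ^ p / (p ! : ℂ)) * ((-(2 * y)) ^ q / (q ! : ℂ)) := by
    intro q
    have h3 := congrArg (fun r : ℝ => (r : ℂ)) (sum_zonalCoeff_div_Gamma l p q)
    push_cast at h3
    have h4 : ∀ j ∈ range (q / 2 + 1), tripleTerm l x y p (q - 2 * j) j =
        ((zonalCoeff l (q - 2 * j) p /
        ((j ! : ℝ) * Real.Gamma (((q - j : ℕ) : ℝ) + ((l + p : ℕ) : ℝ) / 2 + 1)) : ℝ) : ℂ)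
          * (x ^ p * (-y) ^ q) := by
      intro j hj
      have hj' : 2 * j ≤ q := by simp only [mem_range] at hj; omega
      obtain ⟨i, rfl⟩ := Nat.exists_eq_add_of_le hj'
      rw [tripleTerm, show 2 * j + i - 2 * j = i by omega, show 2 * j + i - j = i + j by omega,
        neg_pow y, add_comm (2 * j) i, pow_add (-1 : ℂ) i, pow_mul, neg_one_sq, one_pow]
      push_cast
      ring
    rw [sum_congr rfl h4, ← sum_mul]
    push_cast
    rw [← mul_assoc, h3, neg_pow (2 * y), neg_pow y]
    simp only [mul_pow]
    ring
  rw [tsum_congr h2, tsum_mul_left, Complex.exp_eq_exp_ℂ, NormedSpace.exp_eq_tsum_div]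
  ring

theorem two_pow_mul_kernelTerm_four {n l : ℕ} (hnl : n = l + 1)
    (x y : EuclideanSpace ℝ (Fin (2 * n))) (hz : ‖x‖ * ‖y‖ ≠ 0) (k : ℕ) {w : ℂ}
    (hw : w = Complex.exp (-(Complex.I * Real.pi / 4)) * ((‖x‖ * ‖y‖ : ℝ) : ℂ) / 2) :
    2 ^ l * kernelTerm 4 x y k = ∑ i ∈ range (k / 2 + 1), ∑' j,
      tripleTerm l (2 * w * (Real.cos (InnerProductGeometry.angle x y) : ℂ)) (w ^ 2)
        (k - 2 * i) i j := by
  have hμ : (((2 * n : ℕ) : ℝ) - 2) / 2 = (l : ℝ) := by rw [hnl]; push_cast; ring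
  have hz0 : 0 < ‖x‖ * ‖y‖ := lt_of_le_of_ne (by positivity) hz.symm
  simp only [kernelTerm, hμ, zonalFactor_natCast_eq_sum, besselJ]
  generalize ‖x‖ * ‖y‖ = z at *
  generalize Real.cos (InnerProductGeometry.angle x y) = c
  rw [sum_mul, sum_mul, Complex.ofReal_sum, mul_sum, mul_sum]
  refine sum_congr rfl fun i hi => ?_
  have hi' : 2 * i ≤ k := by simp only [mem_range] at hi; omega
  obtain ⟨p, rfl⟩ := Nat.exists_eq_add_of_le hi'
  rw [show 2 * i + p - 2 * i = p by omega, ← tsum_mul_left, Complex.ofReal_tsum, ← tsum_mul_left,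
    ← tsum_mul_left]
  refine tsum_congr fun j => ?_
  have hpow : z ^ (-(l : ℝ)) * (2 / 4 * z ^ ((4 : ℝ) / 2) / 2) ^
      (2 * (j : ℝ) + 2 * (((2 * i + p : ℕ) : ℝ) + l) / 4) = (z / 2) ^ (4 * j + 2 * i + p) / 2 ^ l := by
    have h1 : 2 / 4 * z ^ ((4 : ℝ) / 2) / 2 = (z / 2) ^ (2 : ℝ) := by
      rw [show (4 : ℝ) / 2 = 2 by norm_num, Real.rpow_two, Real.rpow_two]; ring
    rw [h1, ← Real.rpow_mul (by positivity), Real.rpow_neg hz0.le, Real.rpow_natCast,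
      show 2 * (2 * (j : ℝ) + 2 * (((2 * i + p : ℕ) : ℝ) + l) / 4) =
        ((4 * j + 2 * i + p + l : ℕ) : ℝ) by push_cast; ring, Real.rpow_natCast, pow_add _ _ l,
      div_pow z 2 l]
    field_simp
  have hΓ : (j : ℝ) + 2 * (((2 * i + p : ℕ) : ℝ) + l) / 4 + 1 =
      ((i + j : ℕ) : ℝ) + ((l + p : ℕ) : ℝ) / 2 + 1 := by push_cast; ring
  have hexp : Complex.exp (-(Complex.I * Real.pi * ((2 * i + p : ℕ) : ℂ) / ((4 : ℝ) : ℂ))) =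
      Complex.exp (-(Complex.I * Real.pi / 4)) ^ (2 * i + p) := by
    rw [← Complex.exp_nat_mul]
    congr 1; push_cast; ring
  -- This is what lets ω^(4j) replace the Bessel sign (-1)^j.
  have hω : Complex.exp (-(Complex.I * Real.pi / 4)) ^ 4 = -1 := by
    rw [← Complex.exp_nat_mul, show ((4 : ℕ) : ℂ) * -(Complex.I * Real.pi / 4) =
      -(Real.pi * Complex.I) by push_cast; ring, Complex.exp_neg, Complex.exp_pi_mul_I]
    norm_num
  rw [hΓ, hexp, tripleTerm, hw]
  generalize Complex.exp (-(Complex.I * Real.pi / 4)) = ω at hω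
  have harr : ∀ a b d e G : ℝ, a * b * (z ^ (-(l : ℝ))) * (d / G * e) =
      a * b * d / G * (z ^ (-(l : ℝ)) * e) := by intros; ring
  rw [harr, hpow]
  push_cast
  have h4 : ω ^ (4 * j) = (-1) ^ j := by rw [pow_mul, hω]
  have h5 : (2 * (ω * (z : ℂ) / 2) * (c : ℂ)) ^ p * ((ω * z / 2) ^ 2) ^ (i + 2 * j) =
      (2 * (c : ℂ)) ^ p * (ω ^ (2 * i + p) * (-1) ^ j) * (z / 2) ^ (4 * j + 2 * i + p) := by
    rw [← h4, show 2 * (ω * (z : ℂ) / 2) * (c : ℂ) = (2 * c) * (ω * (z / 2)) by ring,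
      show ω * (z : ℂ) / 2 = ω * (z / 2) by ring, ← pow_mul, mul_pow (2 * (c : ℂ)), mul_assoc, ← pow_add,
      mul_pow, ← pow_add, show p + 2 * (i + 2 * j) = 4 * j + 2 * i + p by ring,
      show 2 * i + p + 4 * j = 4 * j + 2 * i + p by ring]
    ring
  rw [h5]
  have h6 : (2 : ℂ) ^ l ≠ 0 := pow_ne_zero _ two_ne_zero
  field_simp

/-! ### Kummer functions and the power series of D_{-n} -/

theorem hasSum_kummerM (α β w : ℂ) :
    HasSum (fun k : ℕ => Complex.Gamma β * ((ascPochhammer ℂ k).eval α /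
      ((k ! : ℂ) * Complex.Gamma (β + k)) * w ^ k)) (kummerM α β w) := by
  refine HasSum.mul_left _ ?_
  have hr : (Complex.regularizedHGFunSeries {α} {β}).radius = ⊤ :=
    Complex.radius_regularizedHGFunSeries_eq_top (by simp)
  have h := (Complex.regularizedHGFunSeries {α} {β}).hasSum (x := w) (by simp [hr])
  refine h.congr_fun fun k => ?_
  simp [Complex.regularizedHGFunSeries, Complex.regularizedHGFunCoeff,
    FormalMultilinearSeries.ofScalars, smul_eq_mul]

/-- Legendre duplication. It matches the Kummer denominators for β = 1/2 with the factorials (2k)!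
of the even terms; the next lemma does the same for β = 3/2 and the odd terms. -/
theorem Gamma_natCast_add_half_mul_factorial (k : ℕ) :
    Complex.Gamma (1 / 2 + k) * (k ! : ℂ) * 4 ^ k = √Real.pi * ((2 * k)! : ℂ) := by
  have h := Complex.Gamma_mul_Gamma_add_half (1 / 2 + k)
  rw [show (1 / 2 + k : ℂ) + 1 / 2 = k + 1 by ring,
    show 2 * (1 / 2 + k : ℂ) = ((2 * k : ℕ) : ℂ) + 1 by push_cast; ring,
    Complex.Gamma_nat_eq_factorial, Complex.Gamma_nat_eq_factorial,
    show 1 - (((2 * k : ℕ) : ℂ) + 1) = -((2 * k : ℕ) : ℂ) by ring, Complex.cpow_neg,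
    Complex.cpow_natCast, pow_mul] at h
  rw [h]
  norm_num
  field_simp

theorem Gamma_natCast_add_three_half_mul_factorial (k : ℕ) :
    Complex.Gamma (3 / 2 + k) * (k ! : ℂ) * 4 ^ k * 2 = √Real.pi * ((2 * k + 1)! : ℂ) := by
  have h := Complex.Gamma_mul_Gamma_add_half (1 + k)
  rw [show (1 + k : ℂ) + 1 / 2 = 3 / 2 + k by ring, add_comm (1 : ℂ) k,
    show 2 * (k + 1 : ℂ) = ((2 * k + 1 : ℕ) : ℂ) + 1 by push_cast; ring,
    Complex.Gamma_nat_eq_factorial, Complex.Gamma_nat_eq_factorial,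
    show 1 - (((2 * k + 1 : ℕ) : ℂ) + 1) = -((2 * k + 1 : ℕ) : ℂ) by ring, Complex.cpow_neg,
    Complex.cpow_natCast, pow_succ, pow_mul] at h
  rw [mul_comm (Complex.Gamma _), h]
  norm_num
  field_simp

theorem Gamma_one_half_eq_sqrt : Complex.Gamma (1 / 2) = √Real.pi := by
  simpa using Gamma_natCast_add_half_mul_factorial 0

theorem Gamma_three_half_eq_sqrt_div_two : Complex.Gamma (3 / 2) = √Real.pi / 2 := by
  rw [eq_div_iff two_ne_zero]
  simpa using Gamma_natCast_add_three_half_mul_factorial 0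

theorem ne_neg_natCast_of_re_pos {s : ℂ} (hs : 0 < s.re) (k : ℕ) : s ≠ -k := by
  rintro rfl
  simp only [Complex.neg_re, Complex.natCast_re] at hs
  linarith [(k.cast_nonneg : (0 : ℝ) ≤ k)]

/-- The power series `∑ₚ Γ((n + p) / 2) T ^ p / p!`. -/
noncomputable def halfGammaSeries (n : ℕ) (T : ℂ) : ℂ :=
  ∑' p : ℕ, Complex.Gamma ((n + p) / 2) * T ^ p / (p ! : ℂ)

theorem hasSum_halfGammaSeries_even {n : ℕ} (hn : 1 ≤ n) (T : ℂ) :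
    HasSum (fun k : ℕ => Complex.Gamma ((n + (2 * k : ℕ)) / 2) * T ^ (2 * k) / ((2 * k)! : ℂ))
      (Complex.Gamma (n / 2) * kummerM (n / 2) (1 / 2) (T ^ 2 / 4)) := by
  have hre : 0 < ((n : ℂ) / 2).re := by
    have : (0 : ℝ) < n := by exact_mod_cast hn
    rw [show (n : ℂ) / 2 = ((n / 2 : ℝ) : ℂ) by push_cast; ring, Complex.ofReal_re]
    positivity
  have hG := Complex.Gamma_ne_zero_of_re_pos hre
  refine ((hasSum_kummerM (n / 2) (1 / 2) (T ^ 2 / 4)).mul_left (Complex.Gamma (n / 2))).congr_fun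
    fun k => ?_
  have h1 := Gamma_natCast_add_half_mul_factorial k
  have h2 := Complex.Gamma_add_nat_div_Gamma_eq (n := k) _ (ne_neg_natCast_of_re_pos hre)
  have h3 : Complex.Gamma (1 / 2 + k) ≠ 0 :=
    Complex.Gamma_ne_zero_of_re_pos (by simp; positivity)
  have h4 : (k ! : ℂ) ≠ 0 := by exact_mod_cast k.factorial_ne_zero
  have h5 : ((2 * k)! : ℂ) ≠ 0 := by exact_mod_cast (2 * k).factorial_ne_zero
  have h6 : (√Real.pi : ℂ) ≠ 0 := by exact_mod_cast (Real.sqrt_pos.2 Real.pi_pos).ne'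
  rw [← h2, Gamma_one_half_eq_sqrt, div_pow, ← pow_mul,
    show ((n : ℂ) + (2 * k : ℕ)) / 2 = n / 2 + k by push_cast; ring]
  generalize Complex.Gamma (1 / 2 + (k : ℂ)) = X at h1 h3 ⊢
  generalize Complex.Gamma ((n : ℂ) / 2 + k) = Y
  field_simp
  linear_combination Y * T ^ (2 * k) * h1

theorem hasSum_halfGammaSeries_odd (n : ℕ) (T : ℂ) :
    HasSum (fun k : ℕ => Complex.Gamma ((n + (2 * k + 1 : ℕ)) / 2) * T ^ (2 * k + 1) /
      ((2 * k + 1)! : ℂ))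
      (Complex.Gamma ((n + 1) / 2) * T * kummerM ((n + 1) / 2) (3 / 2) (T ^ 2 / 4)) := by
  have hre : 0 < (((n : ℂ) + 1) / 2).re := by
    rw [show ((n : ℂ) + 1) / 2 = (((n + 1) / 2 : ℝ) : ℂ) by push_cast; ring, Complex.ofReal_re]
    positivity
  have hG := Complex.Gamma_ne_zero_of_re_pos hre
  refine ((hasSum_kummerM ((n + 1) / 2) (3 / 2) (T ^ 2 / 4)).mul_left
    (Complex.Gamma ((n + 1) / 2) * T)).congr_fun fun k => ?_
  have h1 := Gamma_natCast_add_three_half_mul_factorial k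
  have h2 := Complex.Gamma_add_nat_div_Gamma_eq (n := k) _ (ne_neg_natCast_of_re_pos hre)
  have h3 : Complex.Gamma (3 / 2 + k) ≠ 0 :=
    Complex.Gamma_ne_zero_of_re_pos (by simp; positivity)
  have h4 : (k ! : ℂ) ≠ 0 := by exact_mod_cast k.factorial_ne_zero
  have h5 : ((2 * k + 1)! : ℂ) ≠ 0 := by exact_mod_cast (2 * k + 1).factorial_ne_zero
  have h6 : (√Real.pi : ℂ) ≠ 0 := by exact_mod_cast (Real.sqrt_pos.2 Real.pi_pos).ne'
  rw [← h2, Gamma_three_half_eq_sqrt_div_two, div_pow, ← pow_mul, pow_succ T,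
    show ((n : ℂ) + (2 * k + 1 : ℕ)) / 2 = (n + 1) / 2 + k by push_cast; ring]
  generalize Complex.Gamma (3 / 2 + (k : ℂ)) = X at h1 h3 ⊢
  generalize Complex.Gamma (((n : ℂ) + 1) / 2 + k) = Y
  field_simp
  linear_combination Y * T * T ^ (2 * k) * h1

theorem hasSum_halfGammaSeries_kummerM {n : ℕ} (hn : 1 ≤ n) (T : ℂ) :
    HasSum (fun p : ℕ => Complex.Gamma ((n + p) / 2) * T ^ p / (p ! : ℂ))
      (Complex.Gamma (n / 2) * kummerM (n / 2) (1 / 2) (T ^ 2 / 4) +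
        Complex.Gamma ((n + 1) / 2) * T * kummerM ((n + 1) / 2) (3 / 2) (T ^ 2 / 4)) :=
  (hasSum_halfGammaSeries_even hn T).even_add_odd (hasSum_halfGammaSeries_odd n T)

theorem hasSum_halfGammaSeries {n : ℕ} (hn : 1 ≤ n) (T : ℂ) :
    HasSum (fun p : ℕ => Complex.Gamma ((n + p) / 2) * T ^ p / (p ! : ℂ))
      (halfGammaSeries n T) :=
  (hasSum_halfGammaSeries_kummerM hn T).summable.hasSum

/-- The parabolic cylinder function of negative integer order as a power series. -/
theorem parabolicCylinderD_neg_natCast {n : ℕ} (hn : 1 ≤ n) (u : ℂ) :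
    parabolicCylinderD (-(n : ℂ)) u = (2 : ℂ) ^ (-(n : ℂ) / 2) * Complex.exp (-(u ^ 2 / 4)) *
      (√Real.pi / (Complex.Gamma (n / 2) * Complex.Gamma ((n + 1) / 2)) *
        halfGammaSeries n (-√2 * u)) := by
  have hre : 0 < ((n : ℂ) / 2).re := by
    have : (0 : ℝ) < n := by exact_mod_cast hn
    rw [show (n : ℂ) / 2 = ((n / 2 : ℝ) : ℂ) by push_cast; ring, Complex.ofReal_re]
    positivity
  have hre' : 0 < (((n : ℂ) + 1) / 2).re := by
    rw [show ((n : ℂ) + 1) / 2 = (((n + 1) / 2 : ℝ) : ℂ) by push_cast; ring, Complex.ofReal_re]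
    positivity
  have hG := Complex.Gamma_ne_zero_of_re_pos hre
  have hG' := Complex.Gamma_ne_zero_of_re_pos hre'
  have hT : (-(√2 : ℂ) * u) ^ 2 / 4 = u ^ 2 / 2 := by
    have : (√2 : ℂ) ^ 2 = 2 := by exact_mod_cast Real.sq_sqrt (by norm_num : (0 : ℝ) ≤ 2)
    rw [mul_pow, neg_sq, this]; ring
  rw [(hasSum_halfGammaSeries hn _).unique (hasSum_halfGammaSeries_kummerM hn _), hT,
    parabolicCylinderD, show -(-(n : ℂ) / 2) = n / 2 by ring,
    show (1 - -(n : ℂ)) / 2 = (n + 1) / 2 by ring, Real.sqrt_mul (by norm_num)]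
  push_cast
  field_simp
  ring

/-! ### Recurrence and derivative of the series F_n -/

theorem halfGammaSeries_zero_right (n : ℕ) : halfGammaSeries n 0 = Complex.Gamma (n / 2) := by
  rw [halfGammaSeries, tsum_eq_single 0 (fun p hp => by simp [hp])]
  simp

theorem hasSum_natCast_mul_halfGamma_term (n : ℕ) (T : ℂ) :
    HasSum (fun p : ℕ => (p : ℂ) / 2 * (Complex.Gamma ((n + p) / 2) * T ^ p / (p ! : ℂ)))
      (T / 2 * halfGammaSeries (n + 1) T) := by
  rw [← hasSum_nat_add_iff' 1]
  simp only [range_one, sum_singleton, Nat.cast_zero, zero_div, zero_mul, sub_zero]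
  refine ((hasSum_halfGammaSeries (Nat.le_add_left 1 n) T).mul_left (T / 2)).congr_fun fun p => ?_
  have h1 : (p ! : ℂ) ≠ 0 := by exact_mod_cast p.factorial_ne_zero
  have h2 : (p : ℂ) + 1 ≠ 0 := by exact_mod_cast p.succ_ne_zero
  rw [Nat.factorial_succ]
  push_cast
  rw [show (n : ℂ) + 1 + p = n + (p + 1) by ring]
  generalize Complex.Gamma (((n : ℂ) + (p + 1)) / 2) = X
  field_simp
  ring

theorem Gamma_natCast_add_two_add_natCast_div_two (n p : ℕ) (h : n + p ≠ 0) :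
    Complex.Gamma (((n + 2 : ℕ) + p) / 2) = ((n : ℂ) + p) / 2 * Complex.Gamma ((n + p) / 2) := by
  rw [← Complex.Gamma_add_one]
  · congr 1; push_cast; ring
  · have : ((n + p : ℕ) : ℂ) ≠ 0 := by exact_mod_cast h
    push_cast at this
    exact div_ne_zero this two_ne_zero

theorem halfGammaSeries_add_two {n : ℕ} (hn : 1 ≤ n) (T : ℂ) :
    halfGammaSeries (n + 2) T =
      n / 2 * halfGammaSeries n T + T / 2 * halfGammaSeries (n + 1) T := by
  refine (hasSum_halfGammaSeries (by omega) T).unique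
    ((((hasSum_halfGammaSeries hn T).mul_left ((n : ℂ) / 2)).add
      (hasSum_natCast_mul_halfGamma_term n T)).congr_fun fun p => ?_)
  rw [Gamma_natCast_add_two_add_natCast_div_two n p (by omega)]
  ring

/-- The case n = 0 of the recurrence: Γ(n/2) has a pole there, and the constant 1 is the limit of
(n/2) Γ(n/2). -/
theorem halfGammaSeries_two (T : ℂ) :
    halfGammaSeries 2 T = 1 + T / 2 * halfGammaSeries 1 T := by
  refine (hasSum_halfGammaSeries (by omega) T).unique
    (((hasSum_ite_eq 0 (1 : ℂ)).add (hasSum_natCast_mul_halfGamma_term 0 T)).congr_fun fun p => ?_)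
  rcases p with _ | p
  · simp
  · have h := Gamma_natCast_add_two_add_natCast_div_two 0 (p + 1) (by omega)
    simp only [zero_add] at h
    rw [h]
    simp
    ring

theorem hasDerivAt_halfGammaSeries {n : ℕ} (hn : 1 ≤ n) (T : ℂ) :
    HasDerivAt (halfGammaSeries n) (halfGammaSeries (n + 1) T) T := by
  have hterm : ∀ (p : ℕ) (y : ℂ), Complex.Gamma ((n + (p + 1 : ℕ)) / 2) *
      (((p + 1 : ℕ) : ℂ) * y ^ p) / ((p + 1)! : ℂ) =
      Complex.Gamma (((n + 1 : ℕ) + p) / 2) * y ^ p / (p ! : ℂ) := by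
    intro p y
    have h1 : (p ! : ℂ) ≠ 0 := by exact_mod_cast p.factorial_ne_zero
    have h2 : (p : ℂ) + 1 ≠ 0 := by exact_mod_cast p.succ_ne_zero
    rw [Nat.factorial_succ]
    push_cast
    rw [show (n : ℂ) + 1 + p = n + (p + 1) by ring]
    generalize Complex.Gamma (((n : ℂ) + (p + 1)) / 2) = X
    field_simp
  have hder : ∀ y : ℂ, HasSum (fun p : ℕ => Complex.Gamma ((n + p) / 2) *
      ((p : ℂ) * y ^ (p - 1)) / (p ! : ℂ)) (halfGammaSeries (n + 1) y) := by
    intro y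
    rw [← hasSum_nat_add_iff' 1]
    simp only [range_one, sum_singleton, Nat.cast_zero, zero_mul, mul_zero, zero_div, sub_zero,
      Nat.add_sub_cancel]
    exact (hasSum_halfGammaSeries (Nat.le_add_left 1 n) y).congr_fun fun p => hterm p y
  rw [← (hder T).tsum_eq]
  -- The derived series at the point R dominates it on the whole ball of radius R, which permits
  -- termwise differentiation.
  set R : ℝ := ‖T‖ + 1
  refine hasDerivAt_tsum_of_isPreconnected (hder (R : ℂ)).summable.norm
    (Metric.isOpen_ball (x := (0 : ℂ)) (ε := R)) (convex_ball 0 R).isPreconnected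
    (g := fun (p : ℕ) (y : ℂ) => Complex.Gamma ((n + p) / 2) * y ^ p / (p ! : ℂ))
    (fun p y _ => ((hasDerivAt_pow p y).const_mul _).div_const _) (fun p y hy => ?_)
    (y₀ := T) (by simp [R]) (hasSum_halfGammaSeries hn T).summable (by simp [R])
  have hy' : ‖y‖ ≤ ‖(R : ℂ)‖ := by
    rw [Complex.norm_real, Real.norm_of_nonneg (by positivity)]
    exact (mem_ball_zero_iff.1 hy).le
  simp only [norm_div, norm_mul, norm_pow]
  gcongr

/-! ### The Fresnel integral on the line through e^{-iπ/4} -/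

/-- The restriction of the series to the line through `e^{-iπ/4}`, on which it grows
polynomially. -/
noncomputable def rayFunction (n : ℕ) (t : ℝ) : ℂ :=
  halfGammaSeries n (2 * Complex.exp (-(Complex.I * Real.pi / 4)) * t)

theorem exp_neg_I_mul_pi_div_four_sq :
    Complex.exp (-(Complex.I * Real.pi / 4)) ^ 2 = -Complex.I := by
  rw [← Complex.exp_nat_mul, show ((2 : ℕ) : ℂ) * -(Complex.I * Real.pi / 4) =
    -(Real.pi / 2 * Complex.I) by push_cast; ring, Complex.exp_neg, Complex.exp_pi_div_two_mul_I,
    Complex.inv_I]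

theorem norm_exp_neg_I_mul_pi_div_four :
    ‖Complex.exp (-(Complex.I * Real.pi / 4))‖ = 1 := by
  rw [show -(Complex.I * Real.pi / 4) = ((-(Real.pi / 4) : ℝ) : ℂ) * Complex.I by push_cast; ring,
    Complex.norm_exp_ofReal_mul_I]

theorem norm_exp_I_mul_sq (t : ℝ) : ‖Complex.exp (Complex.I * t ^ 2)‖ = 1 := by
  rw [show Complex.I * (t : ℂ) ^ 2 = ((t ^ 2 : ℝ) : ℂ) * Complex.I by push_cast; ring,
    Complex.norm_exp_ofReal_mul_I]

theorem hasDerivAt_exp_I_mul_sq (t : ℝ) :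
    HasDerivAt (fun s : ℝ => Complex.exp (Complex.I * (s : ℂ) ^ 2))
      (2 * Complex.I * t * Complex.exp (Complex.I * t ^ 2)) t := by
  have h := ((((hasDerivAt_id (t : ℂ)).pow 2).const_mul Complex.I).cexp).comp_ofReal
  refine h.congr_deriv ?_
  simp
  ring

/-- With F_1' = F_2 = 1 + (T/2) F_1, the terms containing F_1 cancel because ω² = -i. -/
theorem hasDerivAt_exp_mul_rayFunction_one (t : ℝ) :
    HasDerivAt (fun s : ℝ => Complex.exp (Complex.I * (s : ℂ) ^ 2) * rayFunction 1 s)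
      (2 * Complex.exp (-(Complex.I * Real.pi / 4)) * Complex.exp (Complex.I * t ^ 2)) t := by
  have hβ := exp_neg_I_mul_pi_div_four_sq
  unfold rayFunction
  generalize Complex.exp (-(Complex.I * Real.pi / 4)) = β at hβ ⊢
  have h1 := ((hasDerivAt_halfGammaSeries le_rfl (2 * β * t)).comp (t : ℂ)
    ((hasDerivAt_id (t : ℂ)).const_mul (2 * β))).comp_ofReal
  refine ((hasDerivAt_exp_I_mul_sq t).mul h1).congr_deriv ?_
  simp only [Function.comp_apply]
  rw [halfGammaSeries_two]
  linear_combination (2 * t * Complex.exp (Complex.I * t ^ 2) * halfGammaSeries 1 (2 * β * t)) * hβ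

theorem rayFunction_one_zero : rayFunction 1 0 = √Real.pi := by
  rw [rayFunction, Complex.ofReal_zero, mul_zero, halfGammaSeries_zero_right, Nat.cast_one,
    Gamma_one_half_eq_sqrt]

/-- The derivative of the Fresnel function is even, so the sum of its values at t and -t is
constant. -/
theorem exp_mul_rayFunction_one_add_neg (t : ℝ) :
    Complex.exp (Complex.I * (t : ℂ) ^ 2) * rayFunction 1 t +
      Complex.exp (Complex.I * (t : ℂ) ^ 2) * rayFunction 1 (-t) = 2 * √Real.pi := by
  have h : ∀ s : ℝ, HasDerivAt (fun s : ℝ => Complex.exp (Complex.I * (s : ℂ) ^ 2) * rayFunction 1 s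
      + Complex.exp (Complex.I * ((-s : ℝ) : ℂ) ^ 2) * rayFunction 1 (-s)) 0 s := by
    intro s
    refine ((hasDerivAt_exp_mul_rayFunction_one s).add
      ((hasDerivAt_exp_mul_rayFunction_one (-s)).scomp s (hasDerivAt_neg s))).congr_deriv ?_
    simp
  have h2 := is_const_of_deriv_eq_zero (fun s => (h s).differentiableAt) (fun s => (h s).deriv) t 0
  simp only [Complex.ofReal_neg, neg_sq, neg_zero, rayFunction_one_zero] at h2
  rw [h2]
  simp
  ring

theorem sqrt_pi_le_norm_rayFunction_one (t : ℝ) :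
    √Real.pi ≤ ‖rayFunction 1 t‖ ∨ √Real.pi ≤ ‖rayFunction 1 (-t)‖ := by
  have h := congrArg norm (exp_mul_rayFunction_one_add_neg t)
  rw [← mul_add, norm_mul, norm_exp_I_mul_sq, one_mul, norm_mul, Complex.norm_real,
    Real.norm_of_nonneg (Real.sqrt_nonneg _), Complex.norm_ofNat] at h
  have h2 := norm_add_le (rayFunction 1 t) (rayFunction 1 (-t))
  by_contra! hc
  linarith [hc.1, hc.2]

/-- Boundedness of the Fresnel integral, in the form needed here. -/
theorem exists_norm_rayFunction_one_le : ∃ C, 0 ≤ C ∧ ∀ t, ‖rayFunction 1 t‖ ≤ C := by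
  set E : ℝ → ℂ := fun s => Complex.exp (Complex.I * (s : ℂ) ^ 2) * rayFunction 1 s with hE
  have hEn : ∀ t, ‖E t‖ = ‖rayFunction 1 t‖ := fun t => by
    rw [hE, norm_mul, norm_exp_I_mul_sq, one_mul]
  have hEd := hasDerivAt_exp_mul_rayFunction_one
  have hβn := norm_exp_neg_I_mul_pi_div_four
  generalize Complex.exp (-(Complex.I * Real.pi / 4)) = β at hEd hβn
  -- Integration by parts: the correction cancels the non-decaying derivative of E and leaves one of
  -- modulus s⁻², integrable at infinity.
  set B : ℝ → ℂ := fun s =>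
    E s + Complex.I * β * (Complex.exp (Complex.I * (s : ℂ) ^ 2) * ((s⁻¹ : ℝ) : ℂ)) with hB
  have hBd : ∀ t : ℝ, t ≠ 0 → HasDerivAt B
      (-(Complex.I * β * Complex.exp (Complex.I * t ^ 2) * (((t ^ 2)⁻¹ : ℝ) : ℂ))) t := by
    intro t ht
    refine ((hEd t).add (((hasDerivAt_exp_I_mul_sq t).mul
      (hasDerivAt_inv ht).ofReal_comp).const_mul (Complex.I * β))).congr_deriv ?_
    have ht' : (t : ℂ) ≠ 0 := by exact_mod_cast ht
    push_cast
    field_simp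
    linear_combination (2 * β * t ^ 2) * Complex.I_sq
  have hBle : ∀ b : ℝ, 1 ≤ b → ‖B b‖ ≤ ‖B 1‖ + 1 - b⁻¹ := by
    intro b hb
    refine image_norm_le_of_norm_deriv_right_le_deriv_boundary' (a := 1) (b := b)
      (B := fun s => ‖B 1‖ + 1 - s⁻¹) (B' := fun s => (s ^ 2)⁻¹)
      (fun s hs => (hBd s (by linarith [hs.1])).continuousAt.continuousWithinAt)
      (fun s hs => (hBd s (by linarith [hs.1])).hasDerivWithinAt) (by simp)
      (fun s hs => ?_) (fun s hs => ?_) (fun s hs => ?_) ⟨hb, le_rfl⟩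
    · have : s ≠ 0 := by linarith [hs.1]
      exact (continuousAt_const.sub (continuousAt_inv₀ this)).continuousWithinAt
    · have : s ≠ 0 := by linarith [hs.1]
      simpa using ((hasDerivAt_inv this).const_sub (‖B 1‖ + 1)).hasDerivWithinAt
    · rw [norm_neg, norm_mul, norm_mul, norm_mul, norm_exp_I_mul_sq, hβn, Complex.norm_I,
        Complex.norm_real, Real.norm_of_nonneg (by positivity)]
      simp
  obtain ⟨M, hM⟩ := isCompact_Icc.exists_bound_of_continuousOn (s := Set.Icc (0 : ℝ) 1) (f := E)
    (fun s _ => (hEd s).continuousAt.continuousWithinAt)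
  have hpos : ∀ t : ℝ, 0 ≤ t → ‖E t‖ ≤ |M| + ‖B 1‖ + 2 := by
    intro t ht
    rcases le_total t 1 with h1 | h1
    · linarith [hM t ⟨ht, h1⟩, le_abs_self M, norm_nonneg (B 1)]
    · have h2 : E t = B t - Complex.I * β * (Complex.exp (Complex.I * (t : ℂ) ^ 2) *
        ((t⁻¹ : ℝ) : ℂ)) := by simp [hB]
      have h3 : ‖Complex.I * β * (Complex.exp (Complex.I * (t : ℂ) ^ 2) * ((t⁻¹ : ℝ) : ℂ))‖
          = t⁻¹ := by
        rw [norm_mul, norm_mul, norm_mul, norm_exp_I_mul_sq, hβn, Complex.norm_I,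
          Complex.norm_real, Real.norm_of_nonneg (by positivity)]
        simp
      rw [h2]
      refine (norm_sub_le _ _).trans ?_
      rw [h3]
      linarith [hBle t h1, abs_nonneg M]
  refine ⟨|M| + ‖B 1‖ + 2 + 2 * √Real.pi, by positivity, fun t => ?_⟩
  have hs := Real.sqrt_nonneg Real.pi
  rcases le_total 0 t with ht | ht
  · linarith [hpos t ht, hEn t]
  -- Negative t reduces to -t by the reflection identity, at the cost of 2√π.
  · have h1 := exp_mul_rayFunction_one_add_neg t
    have h2 := hpos (-t) (by linarith)
    have h3 : E t = 2 * √Real.pi - E (-t) := by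
      rw [← h1]; simp [hE]
    rw [← hEn, h3]
    refine (norm_sub_le _ _).trans ?_
    rw [norm_mul, Complex.norm_real, Real.norm_of_nonneg hs, Complex.norm_ofNat]
    linarith

/-! ### Growth on the line, from above and below -/

theorem rayFunction_two (t : ℝ) :
    rayFunction 2 t = 1 + Complex.exp (-(Complex.I * Real.pi / 4)) * t * rayFunction 1 t := by
  rw [rayFunction, halfGammaSeries_two, rayFunction]
  ring

theorem rayFunction_add_three (m : ℕ) (t : ℝ) :
    rayFunction (m + 3) t = ((m : ℂ) + 1) / 2 * rayFunction (m + 1) t +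
      Complex.exp (-(Complex.I * Real.pi / 4)) * t * rayFunction (m + 2) t := by
  rw [rayFunction, halfGammaSeries_add_two (Nat.le_add_left 1 m), rayFunction, rayFunction]
  push_cast
  ring

theorem exists_norm_rayFunction_le (m : ℕ) :
    ∃ C, 0 ≤ C ∧ ∀ t, ‖rayFunction (m + 1) t‖ ≤ C * (1 + |t|) ^ m := by
  induction m using Nat.twoStepInduction with
  | zero => simpa using exists_norm_rayFunction_one_le
  | one =>
    obtain ⟨C, hC, h⟩ := exists_norm_rayFunction_one_le
    refine ⟨1 + C, by positivity, fun t => ?_⟩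
    rw [rayFunction_two]
    refine (norm_add_le _ _).trans ?_
    rw [norm_mul, norm_mul, norm_exp_neg_I_mul_pi_div_four, Complex.norm_real, Real.norm_eq_abs,
      norm_one]
    nlinarith [h t, abs_nonneg t, mul_le_mul_of_nonneg_left (h t) (abs_nonneg t)]
  | more m ih₁ ih₂ =>
    obtain ⟨C₁, hC₁, h₁⟩ := ih₁
    obtain ⟨C₂, hC₂, h₂⟩ := ih₂
    refine ⟨((m : ℝ) + 1) / 2 * C₁ + C₂, by positivity, fun t => ?_⟩
    rw [rayFunction_add_three]
    refine (norm_add_le _ _).trans ?_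
    rw [norm_mul, norm_mul, norm_mul, norm_exp_neg_I_mul_pi_div_four, Complex.norm_real,
      Real.norm_eq_abs, show ((m : ℂ) + 1) / 2 = ((((m : ℝ) + 1) / 2 : ℝ) : ℂ) by push_cast; ring,
      Complex.norm_real, Real.norm_of_nonneg (by positivity), one_mul, add_mul]
    have ht : 1 ≤ 1 + |t| := by linarith [abs_nonneg t]
    refine add_le_add ?_ ?_
    · rw [mul_assoc]
      refine mul_le_mul_of_nonneg_left ((h₁ t).trans ?_) (by positivity)
      exact mul_le_mul_of_nonneg_left (pow_le_pow_right₀ ht (by omega)) hC₁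
    · calc |t| * ‖rayFunction (m + 2) t‖ ≤ (1 + |t|) * (C₂ * (1 + |t|) ^ (m + 1)) :=
          mul_le_mul (by linarith) (h₂ t) (norm_nonneg _) (by positivity)
        _ = _ := by ring

/-- Isolates the leading term (ωt)^m F_1; the rest has order m - 1. The factor 1 + |t| on the left
avoids that exponent, which would be negative at m = 0. -/
theorem exists_norm_rayFunction_sub_le (m : ℕ) :
    ∃ C, 0 ≤ C ∧ ∀ t, (1 + |t|) * ‖rayFunction (m + 1) t -
      (Complex.exp (-(Complex.I * Real.pi / 4)) * t) ^ m * rayFunction 1 t‖ ≤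
        C * (1 + |t|) ^ m := by
  induction m using Nat.twoStepInduction with
  | zero => exact ⟨0, le_rfl, fun t => by simp⟩
  | one =>
    refine ⟨1, zero_le_one, fun t => ?_⟩
    rw [rayFunction_two]
    simp
  | more m _ ih =>
    obtain ⟨C₁, hC₁, h₁⟩ := exists_norm_rayFunction_le m
    obtain ⟨C₂, hC₂, h₂⟩ := ih
    refine ⟨((m : ℝ) + 1) / 2 * C₁ + C₂, by positivity, fun t => ?_⟩
    rw [rayFunction_add_three]
    have h₂' := h₂ t
    have hβ := norm_exp_neg_I_mul_pi_div_four
    generalize Complex.exp (-(Complex.I * Real.pi / 4)) = β at hβ h₂' ⊢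
    rw [show ((m : ℂ) + 1) / 2 * rayFunction (m + 1) t + β * t * rayFunction (m + 2) t -
      (β * t) ^ (m + 2) * rayFunction 1 t = ((((m : ℝ) + 1) / 2 : ℝ) : ℂ) * rayFunction (m + 1) t +
        β * t * (rayFunction (m + 1 + 1) t - (β * t) ^ (m + 1) * rayFunction 1 t) by
        push_cast; ring]
    have ht : 0 ≤ 1 + |t| := by linarith [abs_nonneg t]
    have ht1 : 1 ≤ 1 + |t| := by linarith [abs_nonneg t]
    refine (mul_le_mul_of_nonneg_left (norm_add_le _ _) ht).trans ?_
    rw [norm_mul, norm_mul, norm_mul, hβ, Complex.norm_real, Complex.norm_real, Real.norm_eq_abs t,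
      Real.norm_of_nonneg (by positivity), one_mul,
      add_mul (((m : ℝ) + 1) / 2 * C₁), mul_add (1 + |t|)]
    refine add_le_add ?_ ?_
    · calc (1 + |t|) * (((m : ℝ) + 1) / 2 * ‖rayFunction (m + 1) t‖)
          ≤ (1 + |t|) * (((m : ℝ) + 1) / 2 * (C₁ * (1 + |t|) ^ m)) := by gcongr; exact h₁ t
        _ = ((m : ℝ) + 1) / 2 * C₁ * (1 + |t|) ^ (m + 1) := by ring
        _ ≤ _ := by gcongr; omega
    · calc _ = |t| * ((1 + |t|) *
            ‖rayFunction (m + 1 + 1) t - (β * t) ^ (m + 1) * rayFunction 1 t‖) := by ring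
        _ ≤ (1 + |t|) * (C₂ * (1 + |t|) ^ (m + 1)) :=
          mul_le_mul (by linarith) h₂' (by positivity) ht
        _ = _ := by ring

theorem exists_le_norm_rayFunction (m : ℕ) :
    ∃ c, 0 < c ∧ ∃ R : ℝ, 1 ≤ R ∧ ∀ r, R ≤ r →
      c * (1 + r) ^ m ≤ ‖rayFunction (m + 1) r‖ ∨ c * (1 + r) ^ m ≤ ‖rayFunction (m + 1) (-r)‖ := by
  obtain ⟨C, hC, h⟩ := exists_norm_rayFunction_sub_le m
  have hπ : 0 < √Real.pi := Real.sqrt_pos.2 Real.pi_pos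
  -- For r ≥ 1 one has r ≥ (1 + r)/2, so the leading term is at least 2c(1 + r)^m. Once r ≥ C / c
  -- the error takes at most half of it.
  set c := √Real.pi / 2 ^ (m + 1) with hc
  have hc0 : 0 < c := by positivity
  refine ⟨c, hc0, max 1 (C / c), le_max_left _ _, fun r hr => ?_⟩
  have hr1 : 1 ≤ r := (le_max_left _ _).trans hr
  have hrC : C ≤ c * (1 + r) := by
    have := (le_max_right _ _).trans hr
    rw [div_le_iff₀ hc0] at this
    nlinarith
  have key : ∀ t, |t| = r → √Real.pi ≤ ‖rayFunction 1 t‖ →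
      c * (1 + r) ^ m ≤ ‖rayFunction (m + 1) t‖ := by
    intro t ht h1
    have h2 := h t
    have hβ := norm_exp_neg_I_mul_pi_div_four
    generalize Complex.exp (-(Complex.I * Real.pi / 4)) = β at hβ h2
    rw [ht] at h2
    have h3 : ‖rayFunction (m + 1) t - (β * t) ^ m * rayFunction 1 t‖ ≤ c * (1 + r) ^ m := by
      refine le_of_mul_le_mul_left (h2.trans ?_) (show 0 < 1 + r by linarith)
      calc C * (1 + r) ^ m ≤ c * (1 + r) * (1 + r) ^ m := by gcongr
        _ = _ := by ring
    have h4 : ‖(β * t) ^ m * rayFunction 1 t‖ = r ^ m * ‖rayFunction 1 t‖ := by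
      rw [norm_mul, norm_pow, norm_mul, hβ, Complex.norm_real, Real.norm_eq_abs, ht, one_mul]
    have h5 : 2 * (c * (1 + r) ^ m) ≤ r ^ m * ‖rayFunction 1 t‖ := by
      calc 2 * (c * (1 + r) ^ m) = ((1 + r) / 2) ^ m * √Real.pi := by
            rw [hc, div_pow, pow_succ]; field_simp
        _ ≤ r ^ m * ‖rayFunction 1 t‖ := by
            gcongr
            linarith
    have h6 := norm_sub_norm_le ((β * t) ^ m * rayFunction 1 t)
      ((β * t) ^ m * rayFunction 1 t - rayFunction (m + 1) t)
    rw [sub_sub_cancel, norm_sub_rev _ (rayFunction (m + 1) t), h4] at h6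
    linarith
  have habs : |r| = r := abs_of_nonneg (by linarith)
  exact (sqrt_pi_le_norm_rayFunction_one r).imp (key r habs) (key (-r) (by rw [abs_neg, habs]))

/-! ### From the series F_n to the kernel -/

theorem summable_norm_kernelTerm_four {n : ℕ} (hn : 1 ≤ n)
    (x y : EuclideanSpace ℝ (Fin (2 * n))) (hz : ‖x‖ * ‖y‖ ≠ 0) :
    Summable fun k => ‖kernelTerm 4 x y k‖ := by
  obtain ⟨l, rfl⟩ := Nat.exists_eq_add_of_le' hn
  have h := (hasSum_sum_tsum_tripleTerm l _ _).summable.congr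
    (fun k => (two_pow_mul_kernelTerm_four rfl x y hz k rfl).symm)
  -- In ℂ, unconditional summability is already absolute.
  exact ((summable_mul_left_iff (pow_ne_zero l two_ne_zero)).1 h).norm

theorem kernel_four_eq_rayFunction {n : ℕ} (hn : 1 ≤ n) (x y : EuclideanSpace ℝ (Fin (2 * n))) :
    kernel 4 x y = Complex.exp (Complex.I / 2 * ((‖x‖ * ‖y‖ : ℝ) : ℂ) ^ 2) / Complex.Gamma (n / 2) *
      rayFunction n (‖x‖ * ‖y‖ * Real.cos (InnerProductGeometry.angle x y)) := by
  obtain ⟨l, rfl⟩ := Nat.exists_eq_add_of_le' hn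
  have hμ : (((2 * (l + 1) : ℕ) : ℝ) - 2) / 2 = (l : ℝ) := by push_cast; ring
  have hΓ : Complex.Gamma (((l + 1 : ℕ) : ℂ) / 2) = (Real.Gamma (((l : ℝ) + 1) / 2) : ℂ) := by
    rw [← Complex.Gamma_ofReal]; congr 1; push_cast; ring
  rcases eq_or_ne (‖x‖ * ‖y‖) 0 with hz | hz
  -- At z = 0 the right side is F_n(0)/Γ(n/2) = 1, the value by continuity.
  · have hne : Complex.Gamma (((l + 1 : ℕ) : ℂ) / 2) ≠ 0 := by
      rw [hΓ]; exact_mod_cast (Real.Gamma_pos_of_pos (by positivity)).ne'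
    push_cast at hne
    simp [kernel, hz, rayFunction, halfGammaSeries_zero_right, hne]
  · set w : ℂ := Complex.exp (-(Complex.I * Real.pi / 4)) * ((‖x‖ * ‖y‖ : ℝ) : ℂ) / 2 with hw
    have h1 := (hasSum_sum_tsum_tripleTerm l
      (2 * w * (Real.cos (InnerProductGeometry.angle x y) : ℂ)) (w ^ 2)).tsum_eq
    rw [← tsum_congr (fun k => two_pow_mul_kernelTerm_four rfl x y hz k hw), tsum_mul_left] at h1
    have h2 := Gamma_mul_tsum_tripleTerm l
      (2 * w * (Real.cos (InnerProductGeometry.angle x y) : ℂ)) (w ^ 2)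
    rw [← h1] at h2
    have h4 : (4 : ℝ) ^ (2 * (l : ℝ) / 4) = 2 ^ l := by
      rw [show (4 : ℝ) = 2 ^ (2 : ℝ) by norm_num, ← Real.rpow_mul (by norm_num),
        show (2 : ℝ) * (2 * l / 2 ^ (2 : ℝ)) = l by norm_num; ring, Real.rpow_natCast]
    have hw2 : w ^ 2 = -Complex.I * ((‖x‖ * ‖y‖ : ℝ) : ℂ) ^ 2 / 4 := by
      rw [hw, div_pow, mul_pow, exp_neg_I_mul_pi_div_four_sq]; norm_num
    simp only [kernel, if_neg hz, hμ]
    rw [h4, show (2 * (l : ℝ) + 4) / 4 = ((l : ℝ) + 2) / 2 by ring, hΓ]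
    calc _ = (Real.Gamma (((l : ℝ) + 2) / 2) : ℂ) * (2 ^ l * ∑' k, kernelTerm 4 x y k) := by
          push_cast; ring
      _ = _ := by
          rw [h2, rayFunction, halfGammaSeries, hw2]
          congr 1
          · congr 2; ring
          · refine tsum_congr fun p => ?_
            rw [← Complex.Gamma_ofReal, hw]
            push_cast
            congr 3
            ring

theorem norm_kernel_four {n : ℕ} (hn : 1 ≤ n) (x y : EuclideanSpace ℝ (Fin (2 * n))) :
    ‖kernel 4 x y‖ = ‖rayFunction n (‖x‖ * ‖y‖ * Real.cos (InnerProductGeometry.angle x y))‖ /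
      Real.Gamma (n / 2) := by
  have hn0 : (0 : ℝ) < n := by exact_mod_cast hn
  have h : ‖Complex.exp (Complex.I / 2 * ((‖x‖ * ‖y‖ : ℝ) : ℂ) ^ 2)‖ = 1 := by
    rw [show Complex.I / 2 * ((‖x‖ * ‖y‖ : ℝ) : ℂ) ^ 2 =
      (((‖x‖ * ‖y‖) ^ 2 / 2 : ℝ) : ℂ) * Complex.I by push_cast; ring,
      Complex.norm_exp_ofReal_mul_I]
  have hΓ : Complex.Gamma ((n : ℂ) / 2) = (Real.Gamma ((n : ℝ) / 2) : ℂ) := by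
    rw [← Complex.Gamma_ofReal]; push_cast; rfl
  rw [kernel_four_eq_rayFunction hn, norm_mul, norm_div, h, hΓ, Complex.norm_real,
    Real.norm_of_nonneg (Real.Gamma_pos_of_pos (by positivity)).le]
  ring

theorem kernel_four_eq_parabolicCylinderD {n : ℕ} (hn : 1 ≤ n)
    (x y : EuclideanSpace ℝ (Fin (2 * n))) :
    kernel 4 x y =
      (((2 : ℝ) ^ ((n : ℝ) / 2) * Real.Gamma (((n : ℝ) + 1) / 2) / Real.sqrt Real.pi : ℝ) : ℂ)
        * Complex.exp (Complex.I / 2 * (((‖x‖ * ‖y‖) ^ 2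
            * Real.sin (InnerProductGeometry.angle x y) ^ 2 : ℝ) : ℂ))
        * parabolicCylinderD (-(n : ℂ))
            ((Complex.I - 1)
              * ((‖x‖ * ‖y‖ * Real.cos (InnerProductGeometry.angle x y) : ℝ) : ℂ)) := by
  rw [kernel_four_eq_rayFunction hn, parabolicCylinderD_neg_natCast hn, rayFunction]
  generalize ‖x‖ * ‖y‖ = z
  have hsc := Real.sin_sq_add_cos_sq (InnerProductGeometry.angle x y)
  generalize Real.cos (InnerProductGeometry.angle x y) = c at *
  generalize Real.sin (InnerProductGeometry.angle x y) = s at *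
  have hβ : 2 * Complex.exp (-(Complex.I * Real.pi / 4)) = -√2 * (Complex.I - 1) := by
    rw [show -(Complex.I * Real.pi / 4) = ((-(Real.pi / 4) : ℝ) : ℂ) * Complex.I by push_cast; ring,
      Complex.exp_mul_I, ← Complex.ofReal_cos, ← Complex.ofReal_sin, Real.cos_neg, Real.sin_neg,
      Real.cos_pi_div_four, Real.sin_pi_div_four]
    push_cast
    ring
  have hΓ : (Real.Gamma (((n : ℝ) + 1) / 2) : ℂ) = Complex.Gamma (((n : ℂ) + 1) / 2) := by
    rw [← Complex.Gamma_ofReal]; push_cast; rfl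
  have hΓ0 : Complex.Gamma (((n : ℂ) + 1) / 2) ≠ 0 := by
    rw [← hΓ]; exact_mod_cast (Real.Gamma_pos_of_pos (by positivity)).ne'
  have hπ : (√Real.pi : ℂ) ≠ 0 := by exact_mod_cast (Real.sqrt_pos.2 Real.pi_pos).ne'
  have h2 : (((2 : ℝ) ^ ((n : ℝ) / 2) : ℝ) : ℂ) * (2 : ℂ) ^ (-(n : ℂ) / 2) = 1 := by
    rw [Complex.ofReal_cpow (by norm_num)]
    push_cast
    rw [← Complex.cpow_add _ _ two_ne_zero, show (n : ℂ) / 2 + -(n : ℂ) / 2 = 0 by ring,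
      Complex.cpow_zero]
  -- Since (i - 1)² = -2i, the Gaussian factor of D_{-n} is e^{(i/2) z² cos² θ}; only the sin² θ
  -- part of the phase remains outside.
  have hexp : Complex.exp (Complex.I / 2 * (z : ℂ) ^ 2) =
      Complex.exp (Complex.I / 2 * ((z ^ 2 * s ^ 2 : ℝ) : ℂ)) *
        Complex.exp (-(((Complex.I - 1) * ((z * c : ℝ) : ℂ)) ^ 2 / 4)) := by
    rw [← Complex.exp_add]
    congr 1
    have hsc' : (s : ℂ) ^ 2 + (c : ℂ) ^ 2 = 1 := by exact_mod_cast hsc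
    push_cast
    linear_combination -(Complex.I / 2 * (z : ℂ) ^ 2) * hsc' + (z : ℂ) ^ 2 * c ^ 2 / 4 * Complex.I_sq
  rw [hβ, ← mul_assoc (-(√2 : ℂ)), hexp]
  push_cast at h2 ⊢
  rw [hΓ]
  generalize Complex.exp _ = e₁
  generalize Complex.exp _ = e₂
  generalize halfGammaSeries _ _ = H
  generalize (2 : ℂ) ^ (-(n : ℂ) / 2) = b at h2 ⊢
  generalize (((2 : ℝ) ^ ((n : ℝ) / 2) : ℝ) : ℂ) = b' at h2 ⊢
  generalize Complex.Gamma ((n : ℂ) / 2) = G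
  field_simp
  linear_combination -(e₁ * e₂ * H / G) * h2

theorem norm_kernel_four_le {n : ℕ} (hn : 1 ≤ n) :
    ∃ C : ℝ, 0 < C ∧ ∀ x y : EuclideanSpace ℝ (Fin (2 * n)),
      ‖kernel 4 x y‖ ≤ C * (1 + ‖x‖ * ‖y‖) ^ ((((2 * n : ℕ) : ℝ) - 2) / 2) := by
  obtain ⟨l, rfl⟩ := Nat.exists_eq_add_of_le' hn
  have hμ : (((2 * (l + 1) : ℕ) : ℝ) - 2) / 2 = (l : ℝ) := by push_cast; ring
  obtain ⟨C, hC, h⟩ := exists_norm_rayFunction_le l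
  have hΓ : 0 < Real.Gamma (((l + 1 : ℕ) : ℝ) / 2) := Real.Gamma_pos_of_pos (by positivity)
  refine ⟨(C + 1) / Real.Gamma (((l + 1 : ℕ) : ℝ) / 2), by positivity, fun x y => ?_⟩
  rw [hμ, Real.rpow_natCast, norm_kernel_four hn, div_mul_eq_mul_div]
  gcongr
  refine (h _).trans ?_
  have hcos : |‖x‖ * ‖y‖ * Real.cos (InnerProductGeometry.angle x y)| ≤ ‖x‖ * ‖y‖ := by
    rw [abs_mul, abs_of_nonneg (by positivity : 0 ≤ ‖x‖ * ‖y‖)]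
    exact mul_le_of_le_one_right (by positivity) (Real.abs_cos_le_one _)
  gcongr
  linarith

theorem exists_le_norm_kernel_four {n : ℕ} (hn : 1 ≤ n) :
    ∃ c : ℝ, 0 < c ∧ ∃ R : ℝ, ∀ r : ℝ, R ≤ r →
      ∃ x y : EuclideanSpace ℝ (Fin (2 * n)), ‖x‖ * ‖y‖ = r ∧
        c * (1 + r) ^ ((((2 * n : ℕ) : ℝ) - 2) / 2) ≤ ‖kernel 4 x y‖ := by
  obtain ⟨l, rfl⟩ := Nat.exists_eq_add_of_le' hn
  have hμ : (((2 * (l + 1) : ℕ) : ℝ) - 2) / 2 = (l : ℝ) := by push_cast; ring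
  obtain ⟨c, hc, R, hR, h⟩ := exists_le_norm_rayFunction l
  have hΓ : 0 < Real.Gamma (((l + 1 : ℕ) : ℝ) / 2) := Real.Gamma_pos_of_pos (by positivity)
  refine ⟨c / Real.Gamma (((l + 1 : ℕ) : ℝ) / 2), by positivity, R, fun r hr => ?_⟩
  have hr0 : 0 < r := by linarith
  let e : EuclideanSpace ℝ (Fin (2 * (l + 1))) := EuclideanSpace.single ⟨0, by omega⟩ 1
  have he : ‖e‖ = 1 := by simp [e]
  have he0 : e ≠ 0 := norm_ne_zero_iff.1 (by rw [he]; exact one_ne_zero)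
  have hre : ‖r • e‖ = r := by rw [norm_smul, he, mul_one, Real.norm_of_nonneg hr0.le]
  rw [hμ, Real.rpow_natCast, div_mul_eq_mul_div]
  -- Parallel or antiparallel vectors give cos θ = ±1, whichever sign carries the lower bound.
  rcases h r hr with h | h
  · refine ⟨e, r • e, by rw [he, hre, one_mul], ?_⟩
    rw [norm_kernel_four hn, InnerProductGeometry.angle_smul_right_of_pos _ _ hr0,
      InnerProductGeometry.angle_self he0, Real.cos_zero, he, hre, one_mul, mul_one]
    gcongr
  · refine ⟨e, -(r • e), by rw [norm_neg, he, hre, one_mul], ?_⟩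
    rw [norm_kernel_four hn, InnerProductGeometry.angle_neg_right,
      InnerProductGeometry.angle_smul_right_of_pos _ _ hr0,
      InnerProductGeometry.angle_self he0, sub_zero, Real.cos_pi, norm_neg, he, hre, one_mul,
      mul_neg_one]
    gcongr

theorem le_of_forall_mul_rpow_le {a s c C R : ℝ} (hc : 0 < c)
    (h : ∀ r, R ≤ r → c * (1 + r) ^ a ≤ C * (1 + r) ^ s) : a ≤ s := by
  by_contra! hs
  have ht : Filter.Tendsto (fun r : ℝ => (1 + r) ^ (a - s)) Filter.atTop Filter.atTop :=
    (tendsto_rpow_atTop (sub_pos.2 hs)).comp (Filter.tendsto_atTop_add_const_left _ 1 Filter.tendsto_id)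
  obtain ⟨r, hr, hr0, hrR⟩ := ((ht.eventually_gt_atTop (C / c)).and
    ((Filter.eventually_ge_atTop 0).and (Filter.eventually_ge_atTop R))).exists
  have h1 := h r hrR
  have hpos : 0 < 1 + r := by linarith
  rw [div_lt_iff₀ hc, Real.rpow_sub hpos, div_mul_eq_mul_div, lt_div_iff₀ (by positivity)] at hr
  linarith

end RadialFourier

theorem theorem2p5 (m n : ℕ) (hn : 1 ≤ n) (hm : m = 2 * n) :
    -- the series of the kernel converges absolutely
    (∀ x y : EuclideanSpace ℝ (Fin m), ‖x‖ * ‖y‖ ≠ 0 →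
      Summable (fun k : ℕ => ‖RadialFourier.kernelTerm 4 x y k‖)) ∧
    -- closed form
    (∀ x y : EuclideanSpace ℝ (Fin m),
      RadialFourier.kernel 4 x y =
        (((2 : ℝ) ^ ((n : ℝ) / 2) * Real.Gamma (((n : ℝ) + 1) / 2) / Real.sqrt Real.pi : ℝ) : ℂ)
        * Complex.exp (Complex.I / 2 * (((‖x‖ * ‖y‖) ^ 2
            * Real.sin (InnerProductGeometry.angle x y) ^ 2 : ℝ) : ℂ))
        * RadialFourier.parabolicCylinderD (-(n : ℂ))
            ((Complex.I - 1)
              * ((‖x‖ * ‖y‖ * Real.cos (InnerProductGeometry.angle x y) : ℝ) : ℂ))) ∧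
    -- polynomial bound
    (∃ C : ℝ, 0 < C ∧ ∀ x y : EuclideanSpace ℝ (Fin m),
      ‖RadialFourier.kernel 4 x y‖ ≤ C * (1 + ‖x‖ * ‖y‖) ^ (((m : ℝ) - 2) / 2)) ∧
    -- optimality: no smaller exponent is possible
    (∀ s : ℝ, (∃ C : ℝ, ∀ x y : EuclideanSpace ℝ (Fin m),
        ‖RadialFourier.kernel 4 x y‖ ≤ C * (1 + ‖x‖ * ‖y‖) ^ s) →
      ((m : ℝ) - 2) / 2 ≤ s) ∧
    -- optimality: the growth is attained, for all large values of `|x| |y|`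
    (∃ c : ℝ, 0 < c ∧ ∃ R : ℝ, ∀ r : ℝ, R ≤ r →
      ∃ x y : EuclideanSpace ℝ (Fin m), ‖x‖ * ‖y‖ = r ∧
        c * (1 + r) ^ (((m : ℝ) - 2) / 2) ≤ ‖RadialFourier.kernel 4 x y‖) := by

  subst hm
  obtain ⟨c, hc, R, h⟩ := RadialFourier.exists_le_norm_kernel_four hn
  refine ⟨fun x y hz => RadialFourier.summable_norm_kernelTerm_four hn x y hz,
    fun x y => RadialFourier.kernel_four_eq_parabolicCylinderD hn x y,
    RadialFourier.norm_kernel_four_le hn, ?_, c, hc, R, h⟩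
  rintro s ⟨C, hC⟩
  refine RadialFourier.le_of_forall_mul_rpow_le hc (C := C) (R := R) fun r hr => ?_
  obtain ⟨x, y, hxy, hk⟩ := h r hr
  exact hk.trans (hxy ▸ hC x y)
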